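/- Let $s$ be an odd prime, let $1\le p\le q$ and $n=p+q$. An $s^p\times s^q$ full factorial row-column design $d$ places each level combination in $\mathrm{GF}(s)^n$ of $n$ factors $F_1,\dots,F_n$ in exactly one cell of an $s^p\times s^q$ array. The observations follow the model $Y_{ij}=\mu+\tau_i+\rho_j+\gamma_{d[i,j]}+\varepsilon_{ij}$ with uncorrelated errors of mean $0$ and common variance $\sigma^2>0$, where $$\gamma_{(x_1,\dots,x_n)}=\sum_{l}\alpha_{l,x_l}+\sum_{l<m}\sum_{v=1}^{s-1}\beta^{(v)}_{lm,x_l+vx_m},\qquad \sum_{u}\alpha_{l,u}=0,\quad \sum_u\beta^{(v)}_{lm,u}=0 .$$ A main effect $F_l$ (with parameters $\alpha_{l,u}$), or an interaction component $F_lF_m^v$ (with parameters $\beta^{(v)}_{lm,u}$), is unconfounded if its parameters are estimable and their best linear unbiased estimators are uncorrelated with the best linear unbiased estimators of all estimable functions of the remaining parameters of the model. The interaction $F_l\times F_m$ is unconfounded if all its components $F_lF_m^v$, $v=1,\dots,s-1$, are. The design is 2fi-optimal if all its main effects are unconfounded and if, among all $s^p\times s^q$ full factorial row-column designs with this property, it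 has the maximum number of unconfounded two-factor interactions. Let $\mathcal G=\begin{pmatrix}\mathcal G_c\\ \mathcal G_r\end{pmatrix}$ be a matrix over $\mathrm{GF}(s)$ with $n$ columns, where $\mathcal G_c$ has $p$ rows and $\mathcal G_r$ has $q$ rows. If $\mathcal G$ has full row rank, it yields the design in which the rows of the array are labelled by the vectors $x$ of the row space of $\mathcal G_c$, the columns by the vectors $y$ of the row space of $\mathcal G_r$, and the level combination in cell $(x,y)$ is $x+y$. Write $I_v$ for the identity matrix, $J_v$ for the $v\times v$ all-ones matrix, $\mathbf 1_q$ for the all-ones column of length $q$, $H_v$ for the $v\times v$ matrix with entry $1$ where $i+j=v+1$ and $0$ elsewhere, and $M=\begin{pmatrix}1&1\\2&1\end{pmatrix}$. A column belongs to a point of $\mathrm{PG}(p-1,s)$ if it is nonzero and lies in that one-dimensional subspace of $\mathrm{GF}(s)^p$. Then in each of the following cases $\mathcal G$ has full row rank and yields a 2fi-optimal $s^p\times s^q$ full factorial row-column design. (a) $1=p\le q$ and $$\mathcal G_c=(1\mid \mathbf 1_q^T),\qquad \mathcal G_r=(\mathbf 1_q\mid I_q+J_q).$$ (b) $2=p\le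 q$ and $$\mathcal G_c=(I_2\mid M\mid X_*),\qquad \mathcal G_r=\begin{pmatrix}I_2&M+I_2&0\\0&0&I_{q-2}\end{pmatrix},$$ where $X_*$ is any $2\times(q-2)$ matrix without zero columns such that each point of $\mathrm{PG}(1,s)$ appears $\alpha$ or $\alpha+1$ times among the columns of $(I_2\mid M\mid X_*)$, with $\alpha=\lfloor n/(s+1)\rfloor$. Such an $X_*$ exists. (c) $3\le p\le q$ and $$\mathcal G_c=(I_p\mid J_p+H_p\mid Y_*),\qquad \mathcal G_r=\begin{pmatrix}H_p&J_p+2I_p&0\\0&0&I_{q-p}\end{pmatrix},$$ where $Y_*$ is any $p\times(q-p)$ matrix without zero columns such that each point of $\mathrm{PG}(p-1,s)$ appears $\alpha$ or $\alpha+1$ times among the columns of $(I_p\mid J_p+H_p\mid Y_*)$, with $\alpha=\lfloor n(s-1)/(s^p-1)\rfloor$. Such a $Y_*$ exists. -/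

import Mathlib

open MeasureTheory ProbabilityTheory Matrix

universe u

namespace RowColumn

/-! ### Designs and the analysis of variance model -/

/-- An array with row set `R`, column set `C` and one level combination of `n` factors, each at the
`s` levels of `GF(s) = ZMod s`, in every cell. -/
abbrev Design (R C : Type) (n s : ℕ) : Type := R × C → (Fin n → ZMod s)

/-- The design is full factorial (without replication): every level combination is applied
in exactly one cell. -/
def IsFullFactorial {R C : Type} {n s : ℕ} (d : Design R C n s) : Prop :=
  Function.Bijective d

/-- The two-factor interaction components `F_l F_m ^ v`, `l < m`, `v = 1, …, s - 1`. -/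
abbrev InterComp (n s : ℕ) : Type :=
  {c : Fin n × Fin n × ZMod s // c.1 < c.2.1 ∧ c.2.2 ≠ 0}

/-- The treatment effects of the model: main effects `F_l` and interaction components
`F_l F_m ^ v` (interactions of three or more factors are negligible). -/
abbrev TreatmentEffect (n s : ℕ) : Type := Fin n ⊕ InterComp n s

/-- The level of a treatment effect at the level combination `x`: it is `x_l` for `F_l`
and `x_l + v x_m` for `F_l F_m ^ v`. -/
def effectLevel {n s : ℕ} (x : Fin n → ZMod s) : TreatmentEffect n s → ZMod s
  | Sum.inl l => x l
  | Sum.inr c => x c.1.1 + c.1.2.2 * x c.1.2.1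

section Model

variable {R C : Type} [Fintype R] [Fintype C] {n s : ℕ} [Fact s.Prime]

/-- The parameters of the model: overall mean, row effects, column effects, and for each treatment
effect its values at the `s` levels, which sum to zero. So `treat (Sum.inl l) u` is `α_{l,u}` and
`treat (Sum.inr (l, m, v)) u` is `β_{lm,u}^{(v)}`. -/
structure Params (R C : Type) (n s : ℕ) [Fact s.Prime] where
  mu : ℝ
  tau : R → ℝ
  rho : C → ℝ
  treat : TreatmentEffect n s → ZMod s → ℝ
  treat_sum : ∀ e, ∑ u, treat e u = 0

/-- `γ_x`, the sum of all main effects and two-factor interaction components at `x`. -/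
def gamma (θ : Params R C n s) (x : Fin n → ZMod s) : ℝ :=
  ∑ e : TreatmentEffect n s, θ.treat e (effectLevel x e)

/-- The observation `Y_{ij} = μ + τ_i + ρ_j + γ_{d[i,j]} + ε_{ij}`. -/
def observation {Ω : Type u} (ε : R × C → Ω → ℝ) (d : Design R C n s) (θ : Params R C n s)
    (c : R × C) (ω : Ω) : ℝ :=
  θ.mu + θ.tau c.1 + θ.rho c.2 + gamma θ (d c) + ε c ω

/-- The errors are uncorrelated, with mean zero and common variance `σ ^ 2 > 0`. -/
structure IsErrorModel {Ω : Type u} [MeasurableSpace Ω] (P : Measure Ω) (σ : ℝ)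
    (ε : R × C → Ω → ℝ) : Prop where
  sigma_pos : 0 < σ
  memLp : ∀ c, MemLp (ε c) 2 P
  mean_zero : ∀ c, P[ε c] = 0
  variance_eq : ∀ c, Var[ε c; P] = σ ^ 2
  uncorrelated : ∀ c c', c ≠ c' → cov[ε c, ε c'; P] = 0

/-- The linear estimator `∑ a_{ij} Y_{ij}` with coefficients `a`, when the true parameter is `θ`. -/
def linEst {Ω : Type u} (ε : R × C → Ω → ℝ) (d : Design R C n s) (a : R × C → ℝ)
    (θ : Params R C n s) (ω : Ω) : ℝ :=
  ∑ c, a c * observation ε d θ c ω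

/-- `∑ a_{ij} Y_{ij}` is an unbiased estimator of the function `ψ` of the parameters. -/
def IsUnbiased {Ω : Type u} [MeasurableSpace Ω] (P : Measure Ω) (ε : R × C → Ω → ℝ)
    (d : Design R C n s) (a : R × C → ℝ) (ψ : Params R C n s → ℝ) : Prop :=
  ∀ θ, P[linEst ε d a θ] = ψ θ

/-- `∑ a_{ij} Y_{ij}` is the estimator of `ψ` in the model, that is, its best linear unbiased
(equivalently, least squares) estimator. -/
def IsEstimator {Ω : Type u} [MeasurableSpace Ω] (P : Measure Ω) (ε : R × C → Ω → ℝ)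
    (d : Design R C n s) (a : R × C → ℝ) (ψ : Params R C n s → ℝ) : Prop :=
  IsUnbiased P ε d a ψ ∧
    ∀ b, IsUnbiased P ε d b ψ → ∀ θ, Var[linEst ε d a θ; P] ≤ Var[linEst ε d b θ; P]

/-- `ψ` is a function of the parameters other than those of the treatment effect `e`. -/
def IsFreeOf (e : TreatmentEffect n s) (ψ : Params R C n s → ℝ) : Prop :=
  ∀ θ θ' : Params R C n s, θ.mu = θ'.mu → θ.tau = θ'.tau → θ.rho = θ'.rho →
    (∀ e', e' ≠ e → θ.treat e' = θ'.treat e') → ψ θ = ψ θ'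

/-- A main effect or interaction component `e` is unconfounded: its values at all levels can be
estimated, and their estimators are uncorrelated with the estimator of every estimable function of
the remaining parameters (overall mean, row, column and other treatment effects). -/
def EffectUnconfounded {Ω : Type u} [MeasurableSpace Ω] (P : Measure Ω) (ε : R × C → Ω → ℝ)
    (d : Design R C n s) (e : TreatmentEffect n s) : Prop :=
  ∀ u : ZMod s,
    (∃ a, IsEstimator P ε d a (fun θ => θ.treat e u)) ∧
    ∀ a, IsEstimator P ε d a (fun θ => θ.treat e u) →
      ∀ ψ, IsFreeOf e ψ → ∀ b, IsEstimator P ε d b ψ →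
        ∀ θ, cov[linEst ε d a θ, linEst ε d b θ; P] = 0

/-- All main effects are unconfounded. -/
def MainEffectsUnconfounded {Ω : Type u} [MeasurableSpace Ω] (P : Measure Ω)
    (ε : R × C → Ω → ℝ) (d : Design R C n s) : Prop :=
  ∀ l : Fin n, EffectUnconfounded P ε d (Sum.inl l)

/-- The interaction `F_l × F_m`, `l < m`, is unconfounded: all its `s - 1` components are. -/
def InteractionUnconfounded {Ω : Type u} [MeasurableSpace Ω] (P : Measure Ω)
    (ε : R × C → Ω → ℝ) (d : Design R C n s) (l m : Fin n) (h : l < m) : Prop :=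
  ∀ (v : ZMod s) (hv : v ≠ 0), EffectUnconfounded P ε d (Sum.inr ⟨(l, m, v), h, hv⟩)

/-- The number of unconfounded two-factor interactions. -/
noncomputable def numUnconfounded {Ω : Type u} [MeasurableSpace Ω] (P : Measure Ω)
    (ε : R × C → Ω → ℝ) (d : Design R C n s) : ℕ :=
  {lm : Fin n × Fin n | ∃ h : lm.1 < lm.2, InteractionUnconfounded P ε d lm.1 lm.2 h}.ncard

/-- A full factorial row-column design is 2fi-optimal: all its main effects are unconfounded, and
among all full factorial row-column designs of the same size with this property it has the maximum
number of unconfounded two-factor interactions. -/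
def IsTwoFiOptimal {Ω : Type u} [MeasurableSpace Ω] (P : Measure Ω)
    (ε : R × C → Ω → ℝ) (d : Design R C n s) : Prop :=
  IsFullFactorial d ∧ MainEffectsUnconfounded P ε d ∧
    ∀ d' : Design R C n s, IsFullFactorial d' → MainEffectsUnconfounded P ε d' →
      numUnconfounded P ε d' ≤ numUnconfounded P ε d

end Model

/-! ### Array generator matrices -/

section Generator

variable {p q n s : ℕ}

/-- The row-column design constructed from `G = (G_c ; G_r)`. Its rows correspond to the vectors of
the row space of `G_c` and its columns to those of the row space of `G_r`, both indexed by their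
coefficient vectors, so that there are `s ^ p` rows and `s ^ q` columns; the level combination in
a cell is the sum of the two vectors. -/
def designOf (G : Matrix (Fin p ⊕ Fin q) (Fin n) (ZMod s)) :
    Design (Fin p → ZMod s) (Fin q → ZMod s) n s :=
  fun c => c.1 ᵥ* G.toRows₁ + c.2 ᵥ* G.toRows₂

/-- `G` has full row rank and yields a 2fi-optimal full factorial row-column design
(whatever the distribution of the errors). -/
def YieldsTwoFiOptimal [Fact s.Prime] (G : Matrix (Fin p ⊕ Fin q) (Fin n) (ZMod s)) : Prop :=
  LinearIndependent (ZMod s) G.row ∧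
    ∀ (Ω : Type u) [MeasurableSpace Ω] (P : Measure Ω) [IsProbabilityMeasure P] (σ : ℝ)
      (ε : (Fin p → ZMod s) × (Fin q → ZMod s) → Ω → ℝ),
      IsErrorModel P σ ε → IsTwoFiOptimal P ε (designOf G)

/-- Horizontal concatenation `(A | B)`. -/
def hcat {r : Type} {a b s : ℕ} (A : Matrix r (Fin a) (ZMod s)) (B : Matrix r (Fin b) (ZMod s)) :
    Matrix r (Fin (a + b)) (ZMod s) :=
  Matrix.of fun i => Fin.append (A i) (B i)

/-- Vertical concatenation `(A ; B)`. -/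
def vcat {c : Type} {a b s : ℕ} (A : Matrix (Fin a) c (ZMod s)) (B : Matrix (Fin b) c (ZMod s)) :
    Matrix (Fin (a + b)) c (ZMod s) :=
  Matrix.of (Fin.append A B)

/-- The `a × b` matrix with all entries `1`. -/
def ones (a b s : ℕ) : Matrix (Fin a) (Fin b) (ZMod s) := Matrix.of fun _ _ => 1

/-- The `v × v` exchange matrix: `h_{ij} = 1` if `i + j = v + 1` (indices from `1` to `v`),
and `0` otherwise. -/
def exchange (v s : ℕ) : Matrix (Fin v) (Fin v) (ZMod s) :=
  Matrix.of fun i j => if (i.val + 1) + (j.val + 1) = v + 1 then 1 else 0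

/-- The `2 × 2` matrix `M`. -/
def matM (s : ℕ) : Matrix (Fin 2) (Fin 2) (ZMod s) := !![1, 1; 2, 1]

/-- The generator matrix for `p = 1`. -/
def genA (q s : ℕ) : Matrix (Fin 1 ⊕ Fin q) (Fin (1 + q)) (ZMod s) :=
  fromRows (hcat (ones 1 1 s) (ones 1 q s)) (hcat (ones q 1 s) (1 + ones q q s))

/-- `(I_2 | M | X)`. -/
def topB {k s : ℕ} (X : Matrix (Fin 2) (Fin k) (ZMod s)) :
    Matrix (Fin 2) (Fin (2 + 2 + k)) (ZMod s) :=
  hcat (hcat 1 (matM s)) X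

/-- The generator matrix for `p = 2`, `q = 2 + k`. -/
def genB {k s : ℕ} (X : Matrix (Fin 2) (Fin k) (ZMod s)) :
    Matrix (Fin 2 ⊕ Fin (2 + k)) (Fin (2 + 2 + k)) (ZMod s) :=
  fromRows (topB X)
    (vcat (hcat (hcat 1 (matM s + 1)) 0)
          (hcat (hcat 0 0) 1))

/-- `(I_p | J_p + H_p | Y)`. -/
def topC {p k s : ℕ} (Y : Matrix (Fin p) (Fin k) (ZMod s)) :
    Matrix (Fin p) (Fin (p + p + k)) (ZMod s) :=
  hcat (hcat 1 (ones p p s + exchange p s)) Y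

/-- The generator matrix for `p ≥ 3`, `q = p + k`. -/
def genC {p k s : ℕ} (Y : Matrix (Fin p) (Fin k) (ZMod s)) :
    Matrix (Fin p ⊕ Fin (p + k)) (Fin (p + p + k)) (ZMod s) :=
  fromRows (topC Y)
    (vcat (hcat (hcat (exchange p s) (ones p p s + (2 : ZMod s) • 1)) 0)
          (hcat (hcat 0 0) 1))

/-- The number of columns of `A` that belong to the point `x` of the projective geometry. -/
noncomputable def pointCount [Fact s.Prime] (A : Matrix (Fin p) (Fin n) (ZMod s))
    (x : Projectivization (ZMod s) (Fin p → ZMod s)) : ℕ :=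
  {j : Fin n | A.col j ≠ 0 ∧ A.col j ∈ x.submodule}.ncard

/-- Each point of the projective geometry appears `α` or `α + 1` times among the columns of `A`. -/
def IsBalanced [Fact s.Prime] (A : Matrix (Fin p) (Fin n) (ZMod s)) (α : ℕ) : Prop :=
  ∀ x, pointCount A x = α ∨ pointCount A x = α + 1

/-- No column of `A` is a zero vector. -/
def NoZeroCol (A : Matrix (Fin p) (Fin n) (ZMod s)) : Prop := ∀ j, A.col j ≠ 0

end Generator

end RowColumn

/-! Estimators are coefficient vectors, and covariances are σ² times dot products, so an
unconfounded effect is one whose contrasts are orthogonal to all cell means not involving it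
(`EffectOrthogonal`).

Upper bound, for arbitrary designs: if the main effects and all interactions within a set S of
factors are unconfounded, then inside a single column of the array, which has s^p cells, these
factors are pairwise orthogonal. A Rao-type bound gives #S (s - 1) + 1 ≤ s^p
(`card_mul_add_one_le`). Hence the graph of unconfounded interactions has no clique larger than r =
(s^p - 1)/(s - 1), the number of points of PG(p-1, s), and Turán's theorem bounds its edges.

Attainment: in the design of a generator matrix, an effect is unconfounded as soon as its linear
functional vanishes on neither row space (`effectOrthogonal_designOf`). The columns of G_r are
pairwise independent for p ≥ 2, so only G_c matters there: factors whose columns are different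
points of PG(p-1, s) have an unconfounded interaction. Balanced point multiplicities make this graph
contain a balanced complete r-partite graph, which has as many edges as Turán's. For p = 1 the bound
leaves no interactions, and only the main effects need checking. -/

namespace RowColumn
-- Best linear unbiased estimation as Euclidean geometry
section Estimation

variable {R C : Type} {n s : ℕ} [Fact s.Prime]

/-- The expected value of the observation in a cell. -/
def cellMean (d : Design R C n s) (θ : Params R C n s) (c : R × C) : ℝ :=
  θ.mu + θ.tau c.1 + θ.rho c.2 + gamma θ (d c)

/-- Real functions on `ZMod s` with sum zero. -/
def contrasts (s : ℕ) [Fact s.Prime] : Submodule ℝ (ZMod s → ℝ) where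
  carrier := {f | ∑ u, f u = 0}
  add_mem' {f g} hf hg := by
    simp only [Set.mem_ofPred_eq, Pi.add_apply, Finset.sum_add_distrib] at *
    rw [hf, hg, add_zero]
  zero_mem' := by simp
  smul_mem' r f hf := by
    simp only [Set.mem_ofPred_eq, Pi.smul_apply, smul_eq_mul, ← Finset.mul_sum] at *
    rw [hf, mul_zero]

lemma mem_contrasts {f : ZMod s → ℝ} : f ∈ contrasts s ↔ ∑ u, f u = 0 := Iff.rfl

/-- The parameter whose only nonzero entries are those of the treatment effect `e`. -/
noncomputable def effectParam (e : TreatmentEffect n s) (f : ZMod s → ℝ) (hf : f ∈ contrasts s) :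
    Params R C n s where
  mu := 0
  tau := 0
  rho := 0
  treat := Pi.single e f
  treat_sum e' := by
    obtain rfl | h := eq_or_ne e' e
    · rw [Pi.single_eq_same]; exact hf
    · simp [Pi.single_eq_of_ne h]

/-- The zero parameter. -/
def zeroParam : Params R C n s where
  mu := 0
  tau := 0
  rho := 0
  treat := 0
  treat_sum _ := by simp

lemma cellMean_zeroParam (d : Design R C n s) (c : R × C) : cellMean d zeroParam c = 0 := by
  simp [cellMean, gamma, zeroParam]

lemma cellMean_effectParam (d : Design R C n s) (e : TreatmentEffect n s) (f : ZMod s → ℝ)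
    (hf : f ∈ contrasts s) (c : R × C) :
    cellMean d (effectParam e f hf) c = f (effectLevel (d c) e) := by
  simp only [cellMean, gamma, effectParam, Pi.zero_apply, zero_add]
  rw [Finset.sum_eq_single e]
  · simp
  · intro e' _ h
    simp [Pi.single_eq_of_ne h]
  · simp

/-- The parameter `θ` with the entries of the treatment effect `e` replaced by those of `f`. -/
noncomputable def updateEffect (θ : Params R C n s) (e : TreatmentEffect n s) (f : ZMod s → ℝ)
    (hf : f ∈ contrasts s) : Params R C n s where
  mu := θ.mu
  tau := θ.tau
  rho := θ.rho
  treat := Function.update θ.treat e f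
  treat_sum e' := by
    obtain rfl | h := eq_or_ne e' e
    · rw [Function.update_self]; exact hf
    · rw [Function.update_of_ne h]; exact θ.treat_sum e'

lemma cellMean_updateEffect (d : Design R C n s) (θ : Params R C n s) (e : TreatmentEffect n s)
    (f : ZMod s → ℝ) (hf : f ∈ contrasts s) (c : R × C) :
    cellMean d (updateEffect θ e f hf) c =
      cellMean d θ c - θ.treat e (effectLevel (d c) e) + f (effectLevel (d c) e) := by
  simp only [cellMean, gamma, updateEffect]
  rw [← Finset.add_sum_erase _ _ (Finset.mem_univ e),
    ← Finset.add_sum_erase _ (fun e' => θ.treat e' _) (Finset.mem_univ e), Function.update_self]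
  rw [Finset.sum_congr rfl fun e' h => by rw [Function.update_of_ne (Finset.ne_of_mem_erase h)]]
  ring

variable [Fintype R] [Fintype C]

/-- The contrasts of the effect `e` are orthogonal to all cell means not involving `e`. -/
def EffectOrthogonal (d : Design R C n s) (e : TreatmentEffect n s) : Prop :=
  ∀ f ∈ contrasts s, ∀ θ : Params R C n s, θ.treat e = 0 →
    ∑ c, f (effectLevel (d c) e) * cellMean d θ c = 0

lemma linEst_eq {Ω : Type u} {ε : R × C → Ω → ℝ} (d : Design R C n s) (a : R × C → ℝ) (θ : Params R C n s) :
    linEst ε d a θ = fun ω => ∑ c, a c * cellMean d θ c + ∑ c, a c * ε c ω := by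
  ext ω
  simp only [linEst, observation, cellMean, mul_add, Finset.sum_add_distrib]

variable {Ω : Type u} [MeasurableSpace Ω] {P : Measure Ω} {σ : ℝ} {ε : R × C → Ω → ℝ}

lemma memLp_sum (hε : IsErrorModel P σ ε) (a : R × C → ℝ) :
    MemLp (fun ω => ∑ c, a c * ε c ω) 2 P :=
  memLp_finsetSum _ fun c _ => (hε.memLp c).const_mul (a c)

variable [IsProbabilityMeasure P]

/-- The parameters only shift the estimators by constants, so the covariance depends on the
coefficients alone. From here on the probability space plays no role. -/
lemma covariance_linEst (hε : IsErrorModel P σ ε) (d : Design R C n s) (a b : R × C → ℝ)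
    (θ θ' : Params R C n s) :
    cov[linEst ε d a θ, linEst ε d b θ'; P] = σ ^ 2 * ∑ c, a c * b c := by
  classical
  rw [linEst_eq, linEst_eq,
    covariance_const_add_left ((memLp_sum hε a).integrable one_le_two),
    covariance_const_add_right ((memLp_sum hε b).integrable one_le_two),
    covariance_fun_sum_fun_sum (fun c => (hε.memLp c).const_mul (a c))
      (fun c => (hε.memLp c).const_mul (b c)), Finset.mul_sum]
  refine Finset.sum_congr rfl fun c _ => ?_
  rw [Finset.sum_eq_single c]
  · rw [covariance_const_mul_left, covariance_const_mul_right,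
      covariance_self (hε.memLp c).aemeasurable, hε.variance_eq]
    ring
  · intro c' _ h
    rw [covariance_const_mul_left, covariance_const_mul_right, hε.uncorrelated c c' h.symm]
    simp
  · simp

lemma variance_linEst (hε : IsErrorModel P σ ε) (d : Design R C n s) (a : R × C → ℝ)
    (θ : Params R C n s) : Var[linEst ε d a θ; P] = σ ^ 2 * ∑ c, a c * a c := by
  rw [← covariance_linEst hε d a a θ θ, covariance_self]
  rw [linEst_eq]
  exact ((memLp_sum hε a).aemeasurable).const_add _

lemma integral_linEst (hε : IsErrorModel P σ ε) (d : Design R C n s) (a : R × C → ℝ)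
    (θ : Params R C n s) : P[linEst ε d a θ] = ∑ c, a c * cellMean d θ c := by
  rw [linEst_eq, integral_add (integrable_const _) ((memLp_sum hε a).integrable one_le_two),
    integral_finsetSum _ fun c _ => ((hε.memLp c).integrable one_le_two).const_mul (a c)]
  simp [integral_const_mul, hε.mean_zero]

lemma isUnbiased_iff (hε : IsErrorModel P σ ε) {d : Design R C n s} {a : R × C → ℝ}
    {ψ : Params R C n s → ℝ} :
    IsUnbiased P ε d a ψ ↔ ∀ θ, ∑ c, a c * cellMean d θ c = ψ θ := by
  simp only [IsUnbiased, integral_linEst hε]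

lemma isEstimator_iff (hε : IsErrorModel P σ ε) {d : Design R C n s} {a : R × C → ℝ}
    {ψ : Params R C n s → ℝ} :
    IsEstimator P ε d a ψ ↔ (∀ θ, ∑ c, a c * cellMean d θ c = ψ θ) ∧
      ∀ b : R × C → ℝ, (∀ θ, ∑ c, b c * cellMean d θ c = ψ θ) →
        ∑ c, a c * a c ≤ ∑ c, b c * b c := by
  have hσ : 0 < σ ^ 2 := pow_pos hε.sigma_pos 2
  simp only [IsEstimator, isUnbiased_iff hε, variance_linEst hε, mul_le_mul_iff_right₀ hσ]
  exact and_congr_right fun _ => forall_congr' fun b => imp_congr_right fun _ =>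
    ⟨fun h => h zeroParam, fun h _ => h⟩

/-- An unbiased estimator whose coefficients are a vector of cell means is the best one. -/
lemma sum_sq_eq_of_cellMean {d : Design R C n s} {a b : R × C → ℝ} {ψ : Params R C n s → ℝ}
    {θ₀ : Params R C n s} (ha₀ : ∀ c, a c = cellMean d θ₀ c)
    (ha : ∀ θ, ∑ c, a c * cellMean d θ c = ψ θ) (hb : ∀ θ, ∑ c, b c * cellMean d θ c = ψ θ) :
    ∑ c, b c * b c = ∑ c, a c * a c + ∑ c, (b c - a c) * (b c - a c) := by
  -- Unbiasedness of both, tested at `θ₀`, says that `b - a` is orthogonal to `a`; the claim is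
  -- Pythagoras.
  have h : ∑ c, b c * a c = ∑ c, a c * a c := by
    simp only [ha₀] at ha hb ⊢
    rw [hb, ha]
  have : ∑ c, (b c - a c) * (b c - a c) =
      ∑ c, b c * b c - 2 * ∑ c, b c * a c + ∑ c, a c * a c := by
    rw [Finset.mul_sum, ← Finset.sum_sub_distrib, ← Finset.sum_add_distrib]
    exact Finset.sum_congr rfl fun c _ => by ring
  rw [this, h]; ring

lemma isEstimator_of_cellMean (hε : IsErrorModel P σ ε) {d : Design R C n s} {a : R × C → ℝ}
    {ψ : Params R C n s → ℝ} {θ₀ : Params R C n s} (ha₀ : ∀ c, a c = cellMean d θ₀ c)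
    (ha : ∀ θ, ∑ c, a c * cellMean d θ c = ψ θ) : IsEstimator P ε d a ψ := by
  rw [isEstimator_iff hε]
  refine ⟨ha, fun b hb => ?_⟩
  rw [sum_sq_eq_of_cellMean ha₀ ha hb]
  exact le_add_of_nonneg_right (Finset.sum_nonneg fun c _ => mul_self_nonneg _)

lemma IsEstimator.eq_of_cellMean (hε : IsErrorModel P σ ε) {d : Design R C n s} {a b : R × C → ℝ}
    {ψ : Params R C n s → ℝ} {θ₀ : Params R C n s} (ha₀ : ∀ c, a c = cellMean d θ₀ c)
    (ha : ∀ θ, ∑ c, a c * cellMean d θ c = ψ θ) (hb : IsEstimator P ε d b ψ) : b = a := by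
  rw [isEstimator_iff hε] at hb
  have h := hb.2 a ha
  rw [sum_sq_eq_of_cellMean ha₀ ha hb.1] at h
  have h0 : ∑ c, (b c - a c) * (b c - a c) = 0 :=
    le_antisymm (by linarith) (Finset.sum_nonneg fun c _ => mul_self_nonneg _)
  rw [Finset.sum_eq_zero_iff_of_nonneg fun c _ => mul_self_nonneg _] at h0
  ext c
  exact sub_eq_zero.1 (mul_self_eq_zero.1 (h0 c (Finset.mem_univ c)))

/-- Orthogonal projection on a space of real functions on a finite type. -/
lemma exists_sum_sub_mul_eq_zero {ι : Type*} [Fintype ι] (V : Submodule ℝ (ι → ℝ)) (w : ι → ℝ) :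
    ∃ v ∈ V, ∀ v' ∈ V, ∑ i, (w i - v i) * v' i = 0 := by
  let L : EuclideanSpace ℝ ι ≃ₗ[ℝ] (ι → ℝ) := WithLp.linearEquiv 2 ℝ (ι → ℝ)
  obtain ⟨y, hy, z, hz, h⟩ := (V.comap L.toLinearMap).exists_add_mem_mem_orthogonal (L.symm w)
  refine ⟨L y, hy, fun v' hv' => ?_⟩
  have h1 := (Submodule.mem_orthogonal' _ _).1 hz (L.symm v') (by simpa using hv')
  rw [PiLp.inner_apply] at h1
  rw [← h1]
  refine Finset.sum_congr rfl fun i _ => ?_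
  have hw : w i = y i + z i := congrFun (congrArg (fun t => L t) h) i
  have hyi : L y i = y i := rfl
  have hvi : (L.symm v') i = v' i := rfl
  rw [hw, hyi, hvi]
  simp [mul_comm]

/-- Project the cell means of `θ` onto the contrasts of `e`, with projection `g`. The residual is
itself a vector of cell means, with `-g` in place of the effect `e`, and it is the best estimator of
a function free of `e`. Zero covariance with the estimator of each level of `e`, combined with
unbiasedness of the latter, forces `g = 0`. -/
lemma EffectUnconfounded.effectOrthogonal (hε : IsErrorModel P σ ε) {d : Design R C n s}
    {e : TreatmentEffect n s} (h : EffectUnconfounded P ε d e) : EffectOrthogonal d e := by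
  intro f hf θ hθ
  let V : Submodule ℝ (R × C → ℝ) :=
    (contrasts s).map (LinearMap.funLeft ℝ ℝ fun c => effectLevel (d c) e)
  obtain ⟨v, ⟨g, hg, rfl⟩, hv⟩ := exists_sum_sub_mul_eq_zero V (cellMean d θ)
  simp only [LinearMap.funLeft_apply] at hv
  let θ₁ := updateEffect θ e (-g) (neg_mem hg)
  have hb (c) : cellMean d θ₁ c = cellMean d θ c - g (effectLevel (d c) e) := by
    rw [cellMean_updateEffect, hθ]; simp; ring
  have hbV (g' : ZMod s → ℝ) (hg' : g' ∈ contrasts s) :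
      ∑ c, cellMean d θ₁ c * g' (effectLevel (d c) e) = 0 := by
    simp only [hb]
    exact hv _ ⟨g', hg', rfl⟩
  have hfree : IsFreeOf e fun θ' => ∑ c, cellMean d θ₁ c * cellMean d θ' c := by
    intro θ' θ'' hmu htau hrho htreat
    have hmean (c) : cellMean d θ' c =
        cellMean d θ'' c + (θ'.treat e - θ''.treat e) (effectLevel (d c) e) := by
      have h1 := cellMean_updateEffect d θ' e (θ''.treat e) (θ''.treat_sum e) c
      have h2 : cellMean d (updateEffect θ' e (θ''.treat e) (θ''.treat_sum e)) c =
          cellMean d θ'' c := by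
        have : Function.update θ'.treat e (θ''.treat e) = θ''.treat := by
          ext1 e'
          obtain rfl | he := eq_or_ne e' e
          · simp
          · rw [Function.update_of_ne he, htreat e' he]
        simp only [cellMean, gamma, updateEffect, this, hmu, htau, hrho]
      rw [← h2, h1, Pi.sub_apply]; ring
    simp only [hmean, mul_add, Finset.sum_add_distrib]
    rw [hbV _ (sub_mem (θ'.treat_sum e) (θ''.treat_sum e)), add_zero]
  have hest := isEstimator_of_cellMean (ψ := fun θ' => ∑ c, cellMean d θ₁ c * cellMean d θ' c)
    hε (d := d) (a := cellMean d θ₁) (θ₀ := θ₁) (fun _ => rfl) fun _ => rfl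
  have hg0 : g = 0 := by
    ext u
    obtain ⟨⟨a, ha⟩, hcov⟩ := h u
    have h1 := hcov a ha _ hfree _ hest zeroParam
    rw [covariance_linEst hε, mul_eq_zero] at h1
    have h2 := h1.resolve_left (pow_pos hε.sigma_pos 2).ne'
    have ha' := ((isEstimator_iff hε).1 ha).1
    have h3 := ha' θ₁
    -- The same dot product is 0 by uncorrelatedness and `-g u` by unbiasedness at `θ₁`.
    rw [h2] at h3
    simpa [θ₁, updateEffect] using h3
  rw [← hbV f hf]
  refine Finset.sum_congr rfl fun c _ => ?_
  rw [hb, hg0]; simp [mul_comm]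

/-- The estimator can be written down: by orthogonality a centred indicator of the level `u` sees
only the effect `e`, and its coefficients are cell means, so it is the unique best one. `K` is the
number of cells at each level. -/
lemma EffectOrthogonal.effectUnconfounded (hε : IsErrorModel P σ ε) {d : Design R C n s}
    {e : TreatmentEffect n s} (h : EffectOrthogonal d e) {K : ℝ} (hK : K ≠ 0)
    (hd : ∀ F : ZMod s → ℝ, ∑ c, F (effectLevel (d c) e) = K * ∑ u, F u) :
    EffectUnconfounded P ε d e := by
  intro u
  have hs : (s : ℝ) ≠ 0 := Nat.cast_ne_zero.2 (Fact.out : s.Prime).ne_zero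
  let f : ZMod s → ℝ := fun t => K⁻¹ * ((if t = u then 1 else 0) - (s : ℝ)⁻¹)
  have hf : f ∈ contrasts s := by
    rw [mem_contrasts, ← Finset.mul_sum, Finset.sum_sub_distrib]
    simp [ZMod.card, hs]
  have ha (θ : Params R C n s) :
      ∑ c, f (effectLevel (d c) e) * cellMean d θ c = θ.treat e u := by
    have h1 := h f hf (updateEffect θ e 0 (zero_mem _)) (by simp [updateEffect])
    simp only [cellMean_updateEffect, Pi.zero_apply, add_zero, mul_sub,
      Finset.sum_sub_distrib] at h1
    rw [sub_eq_zero.1 h1, hd fun t => f t * θ.treat e t]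
    simp only [f, mul_assoc, sub_mul, ite_mul, one_mul, zero_mul, ← Finset.mul_sum,
      Finset.sum_sub_distrib, Finset.sum_ite_eq', Finset.mem_univ, if_true, θ.treat_sum e]
    field_simp
    simp
  have ha₀ (c) : f (effectLevel (d c) e) = cellMean d (effectParam e f hf) c :=
    (cellMean_effectParam d e f hf c).symm
  refine ⟨⟨_, isEstimator_of_cellMean hε ha₀ ha⟩, fun a hest ψ hψ b hb θ => ?_⟩
  obtain rfl := hest.eq_of_cellMean hε ha₀ ha
  have hb' := ((isEstimator_iff hε).1 hb).1
  -- The coefficients of the estimator are the cell means of `effectParam e f hf`, so its dot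
  -- product with `b` is the value of `ψ` there, which equals that at zero.
  have h0 : ψ (effectParam e f hf) = ψ zeroParam :=
    hψ _ _ rfl rfl rfl fun e' he => by simp [effectParam, zeroParam, Pi.single_eq_of_ne he]
  rw [← hb', ← hb'] at h0
  simp only [cellMean_effectParam, cellMean_zeroParam, mul_zero, Finset.sum_const_zero] at h0
  rw [covariance_linEst hε, mul_eq_zero]
  right
  rw [← h0]
  exact Finset.sum_congr rfl fun c _ => mul_comm _ _

end Estimation
-- Rao-type bound on mutually orthogonal factors in one column
section UpperBound

variable {R C : Type} {n s : ℕ} [Fact s.Prime]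

/-- The contrast of `ZMod s` that compares level zero with the other levels. -/
noncomputable def peak (s : ℕ) [Fact s.Prime] (t : ZMod s) : ℝ := if t = 0 then s - 1 else -1

lemma peak_zero : peak s 0 = s - 1 := by simp [peak]

lemma sum_peak_mul (y : ZMod s) (hy : y ≠ 0) (b : ZMod s) :
    ∑ v, peak s (b + v * y) = 0 := by
  have e : Function.Bijective fun v : ZMod s => b + v * y :=
    Finite.injective_iff_bijective.1 fun v w h => mul_right_cancel₀ hy (add_left_cancel h)
  rw [e.sum_comp (peak s)]
  have h (t : ZMod s) : peak s t = (if t = 0 then (s : ℝ) else 0) - 1 := by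
    unfold peak; split_ifs <;> simp
  simp [h, ZMod.card]

lemma sum_peak : ∑ t, peak s t = 0 := by
  simpa using sum_peak_mul (s := s) 1 one_ne_zero 0

/-- The interaction contrast `peak x * peak y` splits into the interaction components. -/
lemma peak_mul_peak (x y : ZMod s) :
    peak s x * peak s y = ∑ v ∈ Finset.univ.erase (0 : ZMod s), peak s (x + v * y) := by
  have h := Finset.add_sum_erase Finset.univ (fun v : ZMod s => peak s (x + v * y))
    (Finset.mem_univ 0)
  simp only [zero_mul, add_zero] at h
  obtain rfl | hy := eq_or_ne y 0
  · simp only [mul_zero, add_zero, Finset.sum_const, Finset.card_erase_of_mem (Finset.mem_univ _),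
      Finset.card_univ, ZMod.card, nsmul_eq_mul, Nat.cast_pred (Fact.out : s.Prime).pos, peak_zero]
    ring
  -- The sum over all `v` vanishes, so the sum over `v ≠ 0` is `-peak s x`, while `peak s y = -1`.
  · rw [sum_peak_mul y hy] at h
    rw [eq_neg_of_add_eq_zero_right h]
    simp [peak, hy]

lemma peak_sq (x : ZMod s) : peak s x * peak s x = (s - 1) + (s - 2) * peak s x := by
  unfold peak; split_ifs <;> ring

variable [Fintype R] [Fintype C]

/-- If `e` is orthogonal to the columns, its contrasts have sum zero in each column. -/
lemma EffectOrthogonal.sum_column {d : Design R C n s} {e : TreatmentEffect n s}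
    (h : EffectOrthogonal d e) {f : ZMod s → ℝ} (hf : f ∈ contrasts s) (j : C) :
    ∑ i, f (effectLevel (d (i, j)) e) = 0 := by
  classical
  -- Test against the indicator of column `j`, a cell mean with no treatment effects.
  have h1 := h f hf ⟨0, 0, Pi.single j 1, 0, by simp⟩ rfl
  rw [Fintype.sum_prod_type_right, Finset.sum_eq_single j] at h1
  · simpa [cellMean, gamma] using h1
  · intro j' _ hj
    simp [cellMean, gamma, Pi.single_eq_of_ne hj]
  · simp

omit [Fintype C] in
/-- In a column in which the factors of a set `S` are pairwise orthogonal, there are at least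
`#S (s - 1) + 1` cells. -/
lemma card_mul_add_one_le {d : Design R C n s} (S : Finset (Fin n)) [Nonempty R] (j : C)
    (h1 : ∀ l ∈ S, ∀ f ∈ contrasts s, ∑ i, f (effectLevel (d (i, j)) (Sum.inl l)) = 0)
    (h2 : ∀ l ∈ S, ∀ m ∈ S, ∀ (h : l < m) (v : ZMod s) (hv : v ≠ 0), ∀ f ∈ contrasts s,
      ∑ i, f (effectLevel (d (i, j)) (Sum.inr ⟨(l, m, v), h, hv⟩)) = 0) :
    S.card * (s - 1) + 1 ≤ Fintype.card R := by
  have hs : 1 ≤ s := (Fact.out : s.Prime).one_le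
  obtain ⟨i₀⟩ := ‹Nonempty R›
  -- The peaks are shifted so that all of them reach their maximum `s - 1` at the same cell `i₀`.
  let g (l : Fin n) (i : R) : ℝ := peak s (d (i, j) l - d (i₀, j) l)
  have hshift (t : ZMod s) : (fun u => peak s (u - t)) ∈ contrasts s := by
    rw [mem_contrasts, ← sum_peak (s := s)]
    exact (Equiv.subRight t).sum_comp (peak s)
  have hg1 (l) (hl : l ∈ S) : ∑ i, g l i = 0 := h1 l hl _ (hshift (d (i₀, j) l))
  have hlt (l) (hl : l ∈ S) (m) (hm : m ∈ S) (hlm : l < m) : ∑ i, g l i * g m i = 0 := by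
    simp only [g, peak_mul_peak]
    rw [Finset.sum_comm]
    refine Finset.sum_eq_zero fun v hv => ?_
    rw [← h2 l hl m hm hlm v (Finset.ne_of_mem_erase hv) _
      (hshift (d (i₀, j) l + v * d (i₀, j) m))]
    refine Finset.sum_congr rfl fun i _ => ?_
    simp only [effectLevel]
    congr 1; ring
  have hg2 (l) (hl : l ∈ S) (m) (hm : m ∈ S) :
      ∑ i, g l i * g m i = if l = m then (s - 1) * (Fintype.card R : ℝ) else 0 := by
    split_ifs with h
    · subst h
      simp only [g, peak_sq, Finset.sum_add_distrib, ← Finset.mul_sum]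
      rw [show ∑ i, peak s (d (i, j) l - d (i₀, j) l) = 0 from hg1 l hl]
      simp
      ring
    · obtain h | h := lt_or_gt_of_ne h
      · exact hlt l hl m hm h
      · simp only [mul_comm (g l _)]
        exact hlt m hm l hl h
  -- The summands of `H` are orthogonal, so its squared norm is `#R` times the value `H i₀`.
  -- Comparing with the single term `H i₀ ^ 2` and cancelling gives the bound.
  let H (i : R) : ℝ := 1 + ∑ l ∈ S, g l i
  have hH0 : H i₀ = S.card * (s - 1) + 1 := by
    simp [H, g, peak_zero]; ring
  have hH : ∑ i, H i * H i = Fintype.card R * (S.card * (s - 1) + 1) := by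
    have hHi (i) : H i * H i = 1 + 2 * ∑ l ∈ S, g l i + ∑ l ∈ S, ∑ m ∈ S, g l i * g m i := by
      rw [← Finset.sum_mul_sum]; simp only [H]; ring
    simp only [hHi, Finset.sum_add_distrib, ← Finset.mul_sum]
    rw [Finset.sum_comm, Finset.sum_eq_zero hg1, Finset.sum_comm]
    have : ∑ l ∈ S, ∑ i, g l i * ∑ m ∈ S, g m i = ∑ l ∈ S, (s - 1) * (Fintype.card R : ℝ) := by
      refine Finset.sum_congr rfl fun l hl => ?_
      simp only [Finset.mul_sum]
      rw [Finset.sum_comm, Finset.sum_congr rfl fun m hm => hg2 l hl m hm]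
      simp [hl]
    rw [this]
    simp; ring
  have hle : H i₀ * H i₀ ≤ ∑ i, H i * H i :=
    Finset.single_le_sum (f := fun i => H i * H i) (fun i _ => mul_self_nonneg _)
      (Finset.mem_univ i₀)
  rw [hH, hH0] at hle
  have hs' : (0 : ℝ) ≤ s - 1 := by
    rw [sub_nonneg]; exact_mod_cast hs
  have := le_of_mul_le_mul_right hle (by positivity)
  have h3 : ((S.card * (s - 1) + 1 : ℕ) : ℝ) ≤ (Fintype.card R : ℝ) := by
    push_cast [Nat.cast_sub hs]; exact this
  exact_mod_cast h3

end UpperBound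

/-! ### Turán's theorem for arbitrary balanced partitions -/

section Turan

open SimpleGraph

/-- The number of edges of a complete multipartite graph with parts of sizes `α` and `α + 1`. -/
lemma two_mul_card_edgeFinset_of_balanced {V T : Type*} [Fintype V] [Fintype T] [DecidableEq T]
    (K : SimpleGraph V) [DecidableRel K.Adj] (c : V → T) (hK : ∀ v w, K.Adj v w ↔ c v ≠ c w)
    (α : ℕ) (hc : ∀ x, (Finset.univ.filter fun v => c v = x).card = α ∨
      (Finset.univ.filter fun v => c v = x).card = α + 1) :
    2 * K.edgeFinset.card + (2 * α + 1) * Fintype.card V =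
      Fintype.card V ^ 2 + Fintype.card T * (α * (α + 1)) := by
  classical
  rw [← K.sum_degrees_eq_twice_card_edges]
  set N : T → ℕ := fun x => (Finset.univ.filter fun v => c v = x).card with hN
  have hdeg (v : V) : K.degree v + N (c v) = Fintype.card V := by
    rw [← card_neighborFinset_eq_degree, neighborFinset_eq_filter, hN, ← Finset.card_univ,
      ← Finset.card_filter_add_card_filter_not (s := Finset.univ) (fun w => c v ≠ c w)]
    congr 1
    · exact congrArg Finset.card (Finset.filter_congr fun w _ => hK v w)
    · exact congrArg Finset.card (Finset.filter_congr fun w _ => by rw [not_not, eq_comm])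
  have hsum (F : T → ℕ) : ∑ v, F (c v) = ∑ x, N x * F x := by
    rw [← Finset.sum_fiberwise (s := Finset.univ) (g := c)]
    refine Finset.sum_congr rfl fun x _ => ?_
    rw [Finset.sum_congr rfl fun v hv => by rw [(Finset.mem_filter.1 hv).2]]
    simp [hN]
  have h1 : ∑ v, K.degree v + ∑ x, N x * N x = Fintype.card V ^ 2 := by
    rw [← hsum N, ← Finset.sum_add_distrib, Finset.sum_congr rfl fun v _ => hdeg v]
    simp [sq]
  have h2 : ∑ x, N x = Fintype.card V := by
    simpa using (hsum fun _ => 1).symm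
  -- Both `α` and `α + 1` are roots of x² + α(α + 1) = (2α + 1)x, so the sum of squares, and with it
  -- the edge count, depends only on the number of vertices, the number of classes and `α`.
  have h3 : ∑ x, N x * N x + Fintype.card T * (α * (α + 1)) = (2 * α + 1) * Fintype.card V := by
    rw [← h2, Finset.mul_sum, ← smul_eq_mul (Fintype.card T), ← Finset.card_univ,
      ← Finset.sum_const, ← Finset.sum_add_distrib]
    refine Finset.sum_congr rfl fun x _ => ?_
    obtain h | h := hc x
    · rw [show N x = α from h]; ring
    · rw [show N x = α + 1 from h]; ring
  omega

lemma card_filter_mod_eq (n r : ℕ) (x : Fin r) :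
    (Finset.univ.filter fun v : Fin n => (v : ℕ) % r = x).card = n / r ∨
      (Finset.univ.filter fun v : Fin n => (v : ℕ) % r = x).card = n / r + 1 := by
  have h := Nat.count_modEq_card n x.pos x
  have : (Finset.univ.filter fun v : Fin n => (v : ℕ) % r = x).card = n.count (· ≡ x [MOD r]) := by
    rw [Nat.count_eq_card_filter_range]
    refine Finset.card_bij (fun v _ => v) ?_ ?_ ?_
    · intro v hv
      simpa [Nat.ModEq, Nat.mod_eq_of_lt x.2] using hv
    · intro v _ w _ h; exact Fin.ext h
    · intro v hv
      simp only [Finset.mem_filter, Finset.mem_range, Nat.ModEq, Nat.mod_eq_of_lt x.2] at hv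
      exact ⟨⟨v, hv.1⟩, by simpa using hv.2, rfl⟩
  rw [this, h]
  split_ifs <;> simp

/-- **Turán's theorem** with an arbitrary balanced complete multipartite graph. -/
lemma card_edgeFinset_le_of_balanced {n : ℕ} {T : Type*} [Fintype T] [DecidableEq T] [Nonempty T]
    (H K : SimpleGraph (Fin n)) [DecidableRel H.Adj] [DecidableRel K.Adj]
    (hH : H.CliqueFree (Fintype.card T + 1))
    (c : Fin n → T) (hK : ∀ v w, c v ≠ c w → K.Adj v w)
    (hc : ∀ x, (Finset.univ.filter fun v => c v = x).card = n / Fintype.card T ∨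
      (Finset.univ.filter fun v => c v = x).card = n / Fintype.card T + 1) :
    H.edgeFinset.card ≤ K.edgeFinset.card := by
  classical
  set r := Fintype.card T with hr
  have hr0 : 0 < r := Fintype.card_pos
  -- `M` is the complete multipartite graph of `c`. It lies in `K` and has the edge count of the
  -- Turán graph.
  let M : SimpleGraph (Fin n) := (⊤ : SimpleGraph T).comap c
  have hM (v w) : M.Adj v w ↔ c v ≠ c w := by simp [M]
  have h1 : H.edgeFinset.card ≤ (turanGraph n r).edgeFinset.card := by
    convert (isTuranMaximal_turanGraph (n := n) hr0).2 hH
  have h2 := two_mul_card_edgeFinset_of_balanced M c hM _ hc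
  have h3 := two_mul_card_edgeFinset_of_balanced (turanGraph n r)
    (fun v => (⟨v % r, Nat.mod_lt _ hr0⟩ : Fin r)) (fun v w => by simp [turanGraph_adj]) (n / r)
    (fun x => by simpa only [Fin.ext_iff] using card_filter_mod_eq n r x)
  rw [Fintype.card_fin r] at h3
  have h4 : M.edgeFinset.card ≤ K.edgeFinset.card :=
    Finset.card_le_card (edgeFinset_mono fun v w h => hK v w ((hM v w).1 h))
  have h5 : M.edgeFinset.card = (turanGraph n r).edgeFinset.card := by
    rw [← hr] at h2
    linarith
  omega

lemma ncard_lt_adj_eq {n : ℕ} (K : SimpleGraph (Fin n)) [DecidableRel K.Adj] :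
    {lm : Fin n × Fin n | lm.1 < lm.2 ∧ K.Adj lm.1 lm.2}.ncard = K.edgeFinset.card := by
  classical
  rw [Set.ncard_eq_toFinset_card']
  refine Finset.card_bij (fun lm _ => s(lm.1, lm.2)) ?_ ?_ ?_
  · rintro ⟨l, m⟩ h
    simp only [Set.mem_toFinset, Set.mem_ofPred_eq] at h
    simpa using h.2
  · rintro ⟨l, m⟩ h ⟨l', m'⟩ h' heq
    simp only [Set.mem_toFinset, Set.mem_ofPred_eq] at h h'
    simp only [Sym2.eq_iff] at heq
    obtain ⟨rfl, rfl⟩ | ⟨rfl, rfl⟩ := heq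
    · rfl
    · exact absurd h.1 h'.1.not_gt
  · intro e
    induction e with | _ l m
    intro h
    have h : K.Adj l m := by simpa using h
    obtain hlt | hlt := lt_or_gt_of_ne h.ne
    · exact ⟨(l, m), by simpa using ⟨hlt, h⟩, rfl⟩
    · exact ⟨(m, l), by simpa using ⟨hlt, h.symm⟩, Sym2.eq_swap⟩

end Turan

/-! ### The graph of unconfounded interactions -/

section Optimality

variable {R C : Type} [Fintype R] [Fintype C] {n s : ℕ} [Fact s.Prime]
variable {Ω : Type u} [MeasurableSpace Ω] {P : Measure Ω} {σ : ℝ} {ε : R × C → Ω → ℝ}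

/-- The graph of unconfounded two-factor interactions. -/
def unconfoundedGraph (P : Measure Ω) (ε : R × C → Ω → ℝ) (d : Design R C n s) :
    SimpleGraph (Fin n) where
  Adj l m := (∃ h : l < m, InteractionUnconfounded P ε d l m h) ∨
    ∃ h : m < l, InteractionUnconfounded P ε d m l h
  symm.symm _ _ h := h.symm
  loopless.irrefl l h := by
    obtain ⟨h, _⟩ | ⟨h, _⟩ := h <;> exact lt_irrefl _ h

open Classical in
lemma numUnconfounded_eq (P : Measure Ω) (ε : R × C → Ω → ℝ) (d : Design R C n s) :
    numUnconfounded P ε d = (unconfoundedGraph P ε d).edgeFinset.card := by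
  rw [← ncard_lt_adj_eq, numUnconfounded]
  congr 1
  ext ⟨l, m⟩
  simp only [Set.mem_ofPred_eq, unconfoundedGraph]
  constructor
  · rintro ⟨h, h'⟩
    exact ⟨h, Or.inl ⟨h, h'⟩⟩
  · rintro ⟨h, h' | ⟨h', _⟩⟩
    · exact h'
    · exact absurd h h'.not_gt

/-- The factors of a clique are pairwise orthogonal in every column; a single column already gives
the bound. -/
lemma cliqueFree_unconfoundedGraph [IsProbabilityMeasure P] (hε : IsErrorModel P σ ε)
    {d : Design R C n s} (hd : MainEffectsUnconfounded P ε d) [Nonempty R] [Nonempty C] {r : ℕ}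
    (hr : Fintype.card R = r * (s - 1) + 1) :
    (unconfoundedGraph P ε d).CliqueFree (r + 1) := by
  intro S hS
  obtain ⟨j⟩ := ‹Nonempty C›
  have h := card_mul_add_one_le (d := d) S j
    (fun l _ f hf => ((hd l).effectOrthogonal hε).sum_column hf j)
    (fun l hl m hm hlm v hv f hf => by
      obtain ⟨_, h⟩ | ⟨h, _⟩ := hS.isClique hl hm hlm.ne
      · exact ((h v hv).effectOrthogonal hε).sum_column hf j
      · exact absurd h hlm.not_gt)
  have hs : 0 < s - 1 := Nat.sub_pos_of_lt (Fact.out : s.Prime).one_lt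
  rw [hS.card_eq, hr] at h
  have := Nat.le_of_mul_le_mul_right (Nat.le_of_succ_le_succ h) hs
  omega

/-- Turán's bound is attained if the factors are partitioned into balanced classes such that
the interactions of factors in different classes are unconfounded. -/
lemma numUnconfounded_le_of_balanced [IsProbabilityMeasure P] (hε : IsErrorModel P σ ε)
    {d d' : Design R C n s} (hd' : MainEffectsUnconfounded P ε d') [Nonempty R] [Nonempty C]
    {T : Type*} [Fintype T] [DecidableEq T] [Nonempty T]
    (hT : Fintype.card R = Fintype.card T * (s - 1) + 1) (c : Fin n → T)
    (hd : ∀ l m (h : l < m), c l ≠ c m → InteractionUnconfounded P ε d l m h)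
    (hc : ∀ x, (Finset.univ.filter fun v => c v = x).card = n / Fintype.card T ∨
      (Finset.univ.filter fun v => c v = x).card = n / Fintype.card T + 1) :
    numUnconfounded P ε d' ≤ numUnconfounded P ε d := by
  classical
  rw [numUnconfounded_eq, numUnconfounded_eq]
  refine card_edgeFinset_le_of_balanced _ _ (cliqueFree_unconfoundedGraph hε hd' hT) c
    (fun l m h => ?_) hc
  obtain hlm | hlm := lt_or_gt_of_ne fun hlm => h (congrArg c hlm)
  · exact Or.inl ⟨hlm, hd l m hlm h⟩
  · exact Or.inr ⟨hlm, hd m l hlm h.symm⟩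

end Optimality
-- Designs from generator matrices
section Regular

variable {p q n s : ℕ} [Fact s.Prime]

/-- A contrast of a level that moves along the direction `z` is orthogonal to every function that
is constant along `z`. -/
lemma sum_mul_eq_zero_of_translate {A : Type*} [Fintype A] [AddCommGroup A] [Module (ZMod s) A]
    {lev : A → ZMod s} {w : A → ℝ} {f : ZMod s → ℝ} (hf : f ∈ contrasts s) (z : A) {k : ZMod s}
    (hk : k ≠ 0) (hlev : ∀ x (t : ZMod s), lev (x + t • z) = lev x + t * k)
    (hw : ∀ x (t : ZMod s), w (x + t • z) = w x) : ∑ x, f (lev x) * w x = 0 := by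
  -- Translation by `t • z` preserves the sum. Summing over `t` runs the level through all of `ZMod
  -- s`, where the contrast adds up to zero, so `s` times the sum vanishes.
  have h1 (t : ZMod s) : ∑ x, f (lev x + t * k) * w x = ∑ x, f (lev x) * w x := by
    rw [← Equiv.sum_comp (Equiv.addRight (t • z)) (fun x => f (lev x) * w x)]
    simp only [Equiv.coe_addRight, hlev, hw]
  have h2 (b : ZMod s) : ∑ t : ZMod s, f (b + t * k) = 0 := by
    have e : Function.Bijective fun t : ZMod s => b + t * k :=
      Finite.injective_iff_bijective.1 fun v w h => mul_right_cancel₀ hk (add_left_cancel h)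
    rw [e.sum_comp f]; exact hf
  have h3 : ∑ t : ZMod s, ∑ x, f (lev x + t * k) * w x = 0 := by
    rw [Finset.sum_comm]
    simp only [← Finset.sum_mul, h2, zero_mul, Finset.sum_const_zero]
  simp only [h1, Finset.sum_const, Finset.card_univ, ZMod.card, nsmul_eq_mul] at h3
  exact (mul_eq_zero.1 h3).resolve_left (Nat.cast_ne_zero.2 (Fact.out : s.Prime).ne_zero)

lemma effectLevel_add_smul (x z : Fin n → ZMod s) (t : ZMod s) (e : TreatmentEffect n s) :
    effectLevel (x + t • z) e = effectLevel x e + t * effectLevel z e := by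
  cases e <;> simp [effectLevel]; ring

/-- Distinct treatment effects have linearly independent levels. -/
lemma exists_effectLevel_ne_zero {e e' : TreatmentEffect n s} (h : e' ≠ e) :
    ∃ z, effectLevel z e ≠ 0 ∧ effectLevel z e' = 0 := by
  obtain l | ⟨⟨l, m, v⟩, hlm, hv⟩ := e <;> obtain l' | ⟨⟨l', m', v'⟩, hlm', hv'⟩ := e' <;>
    simp only [effectLevel] at *
  · have : l ≠ l' := fun h' => h (by rw [h'])
    exact ⟨Pi.single l 1, by simp, by simp [this.symm]⟩
  · by_cases h1 : l = l'
    · subst h1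
      exact ⟨v' • Pi.single l 1 - Pi.single m' 1, by simp [hlm'.ne, hv'],
        by simp [hlm'.ne, hlm'.ne']⟩
    · by_cases h2 : l = m'
      · subst h2
        exact ⟨v' • Pi.single l' 1 - Pi.single l 1, by simp [hlm'.ne'],
          by simp [hlm'.ne, hlm'.ne']⟩
      · exact ⟨Pi.single l 1, by simp, by simp [Ne.symm h1, Ne.symm h2]⟩
  · by_cases h1 : l = l'
    · subst h1
      exact ⟨Pi.single m 1, by simp [hlm.ne, hv], by simp [hlm.ne]⟩
    · exact ⟨Pi.single l 1, by simp [hlm.ne'], by simp [Ne.symm h1]⟩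
  · by_cases h1 : l ≠ l' ∧ l ≠ m'
    · exact ⟨Pi.single l 1, by simp [hlm.ne'], by simp [h1.1.symm, h1.2.symm]⟩
    · by_cases h2 : m ≠ l' ∧ m ≠ m'
      · exact ⟨Pi.single m 1, by simp [hlm.ne, hv], by simp [h2.1.symm, h2.2.symm]⟩
      -- Both pairs are increasing and the first lies in the second, so they coincide and only `v`
      -- and `v'` differ.
      · obtain ⟨rfl, rfl⟩ : l = l' ∧ m = m' := by
          rw [Fin.lt_def] at hlm hlm'
          simp only [Fin.ext_iff, ne_eq] at *
          omega
        refine ⟨v' • Pi.single l 1 - Pi.single m 1, ?_, by simp [hlm.ne, hlm.ne']⟩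
        have : v' ≠ v := by
          rintro rfl; exact h rfl
        simpa [hlm.ne, hlm.ne', ← sub_eq_add_neg, sub_eq_zero] using this

lemma designOf_add_smul (G : Matrix (Fin p ⊕ Fin q) (Fin n) (ZMod s))
    (c z : (Fin p → ZMod s) × (Fin q → ZMod s)) (t : ZMod s) :
    designOf G (c + t • z) = designOf G c + t • designOf G z := by
  simp only [designOf, Prod.fst_add, Prod.snd_add, Prod.smul_fst, Prod.smul_snd, add_vecMul,
    smul_vecMul, smul_add]
  abel

lemma isFullFactorial_designOf {G : Matrix (Fin p ⊕ Fin q) (Fin n) (ZMod s)} (hn : p + q = n)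
    (hG : LinearIndependent (ZMod s) G.row) : IsFullFactorial (designOf G) := by
  rw [IsFullFactorial, Fintype.bijective_iff_injective_and_card]
  constructor
  · rintro ⟨x, y⟩ ⟨x', y'⟩ h
    have key (x : Fin p → ZMod s) (y : Fin q → ZMod s) :
        designOf G (x, y) = Sum.elim x y ᵥ* G := by
      have h := sumElim_vecMul_fromRows G.toRows₁ G.toRows₂ x y
      rw [fromRows_toRows] at h
      exact h.symm
    rw [key, key] at h
    have h' := vecMul_injective_iff.2 hG h
    have hx : x = x' := funext fun i => congrFun h' (Sum.inl i)
    have hy : y = y' := funext fun i => congrFun h' (Sum.inr i)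
    rw [hx, hy]
  · simp [ZMod.card, ← pow_add, hn]

/-- The functional of the effect `e` does not vanish on the row space of `B`. -/
def Detects {r : Type*} (B : Matrix r (Fin n) (ZMod s)) (e : TreatmentEffect n s) : Prop :=
  ∃ i, effectLevel (B i) e ≠ 0

/-- Each term of the cell mean is constant along a direction that changes the level of `e`: a row of
G_r moves within a row of the array, a row of G_c within a column, and for another effect full
factoriality provides a direction in the kernel of that effect. -/
lemma effectOrthogonal_designOf {G : Matrix (Fin p ⊕ Fin q) (Fin n) (ZMod s)}
    (hd : IsFullFactorial (designOf G)) {e : TreatmentEffect n s}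
    (h₁ : Detects G.toRows₁ e) (h₂ : Detects G.toRows₂ e) :
    EffectOrthogonal (designOf G) e := by
  intro f hf θ hθ
  have hlev (z : (Fin p → ZMod s) × (Fin q → ZMod s)) (x) (t : ZMod s) :
      effectLevel (designOf G (x + t • z)) e =
        effectLevel (designOf G x) e + t * effectLevel (designOf G z) e := by
    rw [designOf_add_smul, effectLevel_add_smul]
  obtain ⟨i₁, h₁⟩ := h₁
  obtain ⟨i₂, h₂⟩ := h₂
  have hz₁ : designOf G (Pi.single i₁ 1, 0) = G.toRows₁ i₁ := by
    ext j; simp [designOf]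
  have hz₂ : designOf G (0, Pi.single i₂ 1) = G.toRows₂ i₂ := by
    ext j; simp [designOf]
  have hrow : ∑ c, f (effectLevel (designOf G c) e) * (θ.mu + θ.tau c.1) = 0 :=
    sum_mul_eq_zero_of_translate (w := fun c => θ.mu + θ.tau c.1) hf (0, Pi.single i₂ 1) (by rwa [← hz₂] at h₂) (hlev _)
      fun x t => by simp
  have hcol : ∑ c, f (effectLevel (designOf G c) e) * θ.rho c.2 = 0 :=
    sum_mul_eq_zero_of_translate (w := fun c => θ.rho c.2) hf (Pi.single i₁ 1, 0) (by rwa [← hz₁] at h₁) (hlev _)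
      fun x t => by simp
  have htreat (e') : ∑ c, f (effectLevel (designOf G c) e) *
      θ.treat e' (effectLevel (designOf G c) e') = 0 := by
    obtain rfl | he := eq_or_ne e' e
    · simp [hθ]
    · obtain ⟨z, hz, hz'⟩ := exists_effectLevel_ne_zero he
      obtain ⟨c, rfl⟩ := hd.2 z
      refine sum_mul_eq_zero_of_translate (w := fun c => θ.treat e' (effectLevel (designOf G c) e'))
        hf c hz (hlev _) fun x t => ?_
      rw [designOf_add_smul, effectLevel_add_smul, hz', mul_zero, add_zero]
  simp only [cellMean, mul_add, gamma, Finset.mul_sum, Finset.sum_add_distrib] at hrow ⊢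
  rw [hrow, hcol, Finset.sum_comm, Finset.sum_eq_zero fun e' _ => htreat e']
  simp

/-- A nonzero linear functional takes every value equally often, here s^(n-1) times. -/
lemma exists_sum_effectLevel_eq {R C : Type} [Fintype R] [Fintype C] {d : Design R C n s}
    (hd : IsFullFactorial d) (e : TreatmentEffect n s) :
    ∃ K : ℝ, K ≠ 0 ∧ ∀ F : ZMod s → ℝ, ∑ c, F (effectLevel (d c) e) = K * ∑ u, F u := by
  obtain ⟨z, hz⟩ : ∃ z, effectLevel z e ≠ 0 := by
    obtain l | ⟨⟨l, m, v⟩, hlm, hv⟩ := e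
    · exact ⟨Pi.single l 1, by simp [effectLevel]⟩
    · exact ⟨Pi.single l 1, by simp [effectLevel, hlm.ne']⟩
  have hs : (s : ℝ) ≠ 0 := Nat.cast_ne_zero.2 (Fact.out : s.Prime).ne_zero
  refine ⟨(s : ℝ) ^ n / s, div_ne_zero (pow_ne_zero _ hs) hs, fun F => ?_⟩
  rw [hd.sum_comp fun x => F (effectLevel x e)]
  have hf : (fun u => F u - (∑ u, F u) / s) ∈ contrasts s := by
    rw [mem_contrasts, Finset.sum_sub_distrib]
    simp [ZMod.card]; field_simp; simp
  have h := sum_mul_eq_zero_of_translate (A := Fin n → ZMod s) (lev := fun x => effectLevel x e)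
    (w := fun _ => 1) hf z hz (fun x t => effectLevel_add_smul x z t e) fun _ _ => rfl
  simp only [mul_one, Finset.sum_sub_distrib] at h
  rw [sub_eq_zero.1 h]
  simp [ZMod.card]; ring

/-- A generator matrix of full row rank yields an optimal design if it confounds no main effect
and only interactions of factors in the same class of a balanced partition into
`(s ^ p - 1) / (s - 1)` classes. -/
lemma yieldsTwoFiOptimal_of_balanced {G : Matrix (Fin p ⊕ Fin q) (Fin n) (ZMod s)}
    (hn : p + q = n) (hG : LinearIndependent (ZMod s) G.row)
    {T : Type*} [Fintype T] [DecidableEq T] [Nonempty T]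
    (hT : s ^ p = Fintype.card T * (s - 1) + 1) (c : Fin n → T)
    (hmain : ∀ l, Detects G.toRows₁ (Sum.inl l) ∧ Detects G.toRows₂ (Sum.inl l))
    (hinter : ∀ l m v, ∀ h : l < m ∧ v ≠ 0, c l ≠ c m →
      Detects G.toRows₁ (Sum.inr ⟨(l, m, v), h⟩) ∧ Detects G.toRows₂ (Sum.inr ⟨(l, m, v), h⟩))
    (hc : ∀ x, (Finset.univ.filter fun v => c v = x).card = n / Fintype.card T ∨
      (Finset.univ.filter fun v => c v = x).card = n / Fintype.card T + 1) :
    YieldsTwoFiOptimal.{u} G := by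
  have hd := isFullFactorial_designOf hn hG
  refine ⟨hG, fun Ω _ P _ σ ε hε => ⟨hd, ?_, fun d' _ hd' => ?_⟩⟩
  · intro l
    obtain ⟨K, hK, hsum⟩ := exists_sum_effectLevel_eq hd (Sum.inl l)
    exact (effectOrthogonal_designOf hd (hmain l).1 (hmain l).2).effectUnconfounded hε hK hsum
  · refine numUnconfounded_le_of_balanced hε hd' (by simpa [ZMod.card] using hT) c
      (fun l m h hlm v hv => ?_) hc
    obtain ⟨K, hK, hsum⟩ := exists_sum_effectLevel_eq hd (Sum.inr ⟨(l, m, v), h, hv⟩)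
    have := hinter l m v ⟨h, hv⟩ hlm
    exact (effectOrthogonal_designOf hd this.1 this.2).effectUnconfounded hε hK hsum

end Regular
-- The matrices of the three cases
section Constructions

variable {p q n s : ℕ} [Fact s.Prime]

/-! ### Pairwise independent columns -/

/-- The columns of the matrix are nonzero and pairwise linearly independent. -/
structure PairwiseIndepCols {r : Type*} {n : ℕ} (B : Matrix r (Fin n) (ZMod s)) : Prop where
  ne_zero : ∀ l, ∃ i, B i l ≠ 0
  add_ne_zero : ∀ l m, l ≠ m → ∀ v : ZMod s, v ≠ 0 → ∃ i, B i l + v * B i m ≠ 0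

lemma PairwiseIndepCols.detects {r : Type*} {B : Matrix r (Fin n) (ZMod s)}
    (hB : PairwiseIndepCols B) (e : TreatmentEffect n s) : Detects B e := by
  obtain l | ⟨⟨l, m, v⟩, hlm, hv⟩ := e
  · exact hB.ne_zero l
  · exact hB.add_ne_zero l m hlm.ne v hv

/-- Two-rowed matrices with nonzero maximal minors have pairwise independent columns. -/
lemma pairwiseIndepCols_of_minors {B : Matrix (Fin 2) (Fin n) (ZMod s)} (hn : 2 ≤ n)
    (h : ∀ l m, l < m → B 0 l * B 1 m - B 1 l * B 0 m ≠ 0) : PairwiseIndepCols B := by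
  have h' (l m) (hlm : l ≠ m) : B 0 l * B 1 m - B 1 l * B 0 m ≠ 0 := by
    obtain hlm | hlm := lt_or_gt_of_ne hlm
    · exact h l m hlm
    · intro h0
      refine h m l hlm ?_
      linear_combination -h0
  constructor
  · intro l
    have : Nontrivial (Fin n) := Fin.nontrivial_iff_two_le.2 hn
    obtain ⟨m, hm⟩ := exists_ne l
    by_contra! h0
    exact h' l m hm.symm (by simp [h0])
  · intro l m hlm v hv
    by_contra! h0
    refine h' l m hlm ?_
    linear_combination B 1 m * h0 0 - B 0 m * h0 1

/-- Serves both blocks of case (c), with `c = 1` and `c = 2`. As `p ≥ 3`, some coordinate avoids the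
special coordinates of any two columns; there the unit columns are 0 and the others are 1. For two
columns of the second kind, comparing this coordinate with `ρ j` would give `c = 0`. -/
lemma pairwiseIndepCols_unit_ones {E : Matrix (Fin p) (Fin (p + p)) (ZMod s)} (hp : 3 ≤ p)
    {c : ZMod s} (hc : c ≠ 0) {π ρ : Fin p → Fin p}
    (hπ : π.Injective) (hρ : ρ.Injective)
    (h₁ : ∀ a i, E a (Fin.castAdd p i) = if a = π i then 1 else 0)
    (h₂ : ∀ a j, E a (Fin.natAdd p j) = 1 + if a = ρ j then c else 0) :
    PairwiseIndepCols E := by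
  have hex (x y : Fin p) : ∃ a, a ≠ x ∧ a ≠ y := by
    have : ({x, y} : Finset (Fin p)).card < Fintype.card (Fin p) :=
      (Finset.card_le_two).trans_lt (by rw [Fintype.card_fin]; exact hp)
    obtain ⟨a, ha⟩ := Finset.exists_mem_notMem_of_card_lt_card
      (this.trans_eq Finset.card_univ.symm)
    exact ⟨a, by simpa using ha.2⟩
  constructor
  · intro l
    induction l using Fin.addCases with
    | left i => exact ⟨π i, by simp [h₁]⟩
    | right j =>
      obtain ⟨a, ha, -⟩ := hex (ρ j) (ρ j)
      exact ⟨a, by simp [-Fin.natAdd_eq_addNat, h₂, ha]⟩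
  · intro l m hlm v hv
    induction l using Fin.addCases with
    | left i =>
      induction m using Fin.addCases with
      | left i' =>
        have : π i ≠ π i' := hπ.ne fun h => hlm (by rw [h])
        exact ⟨π i, by simp [h₁, this]⟩
      | right j =>
        obtain ⟨a, ha, ha'⟩ := hex (π i) (ρ j)
        exact ⟨a, by simp [-Fin.natAdd_eq_addNat, h₁, h₂, ha, ha', hv]⟩
    | right j =>
      induction m using Fin.addCases with
      | left i =>
        obtain ⟨a, ha, ha'⟩ := hex (π i) (ρ j)
        exact ⟨a, by simp [-Fin.natAdd_eq_addNat, h₁, h₂, ha, ha']⟩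
      | right j' =>
        have hj : ρ j ≠ ρ j' := hρ.ne fun h => hlm (by rw [h])
        by_contra! h0
        obtain ⟨a, ha, ha'⟩ := hex (ρ j) (ρ j')
        have h1 := h0 a
        have h3 := h0 (ρ j)
        simp only [h₂, ha, ha', hj, if_false, if_true, add_zero, mul_one] at h1 h3
        exact hc (by linear_combination h3 - h1)

/-! ### Generator matrices in block form -/

/-- The common form of the generator matrices for `p ≥ 2`. -/
def blockGen {k : ℕ} (B C D : Matrix (Fin p) (Fin p) (ZMod s))
    (Y : Matrix (Fin p) (Fin k) (ZMod s)) :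
    Matrix (Fin p ⊕ Fin (p + k)) (Fin (p + p + k)) (ZMod s) :=
  fromRows (hcat (hcat 1 B) Y) (vcat (hcat (hcat C D) 0) (hcat (hcat 0 0) 1))

section Blocks

variable {r : Type} {a b s : ℕ}

@[simp] lemma hcat_castAdd (A : Matrix r (Fin a) (ZMod s)) (B : Matrix r (Fin b) (ZMod s))
    (i : r) (j : Fin a) : hcat A B i (Fin.castAdd b j) = A i j :=
  Fin.append_left _ _ _

@[simp] lemma hcat_natAdd (A : Matrix r (Fin a) (ZMod s)) (B : Matrix r (Fin b) (ZMod s))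
    (i : r) (j : Fin b) : hcat A B i (Fin.natAdd a j) = B i j :=
  Fin.append_right _ _ _

@[simp] lemma vcat_castAdd (A : Matrix (Fin a) r (ZMod s)) (B : Matrix (Fin b) r (ZMod s))
    (i : Fin a) (j : r) : vcat A B (Fin.castAdd b i) j = A i j :=
  congrFun (Fin.append_left (α := r → ZMod s) A B i) j

@[simp] lemma vcat_natAdd (A : Matrix (Fin a) r (ZMod s)) (B : Matrix (Fin b) r (ZMod s))
    (i : Fin b) (j : r) : vcat A B (Fin.natAdd a i) j = B i j :=
  congrFun (Fin.append_right (α := r → ZMod s) A B i) j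

lemma vecMul_hcat_castAdd [Fintype r] (x : r → ZMod s) (A : Matrix r (Fin a) (ZMod s))
    (B : Matrix r (Fin b) (ZMod s)) (j : Fin a) :
    (x ᵥ* hcat A B) (Fin.castAdd b j) = (x ᵥ* A) j := by
  simp [vecMul, dotProduct]

lemma vecMul_hcat_natAdd [Fintype r] (x : r → ZMod s) (A : Matrix r (Fin a) (ZMod s))
    (B : Matrix r (Fin b) (ZMod s)) (j : Fin b) :
    (x ᵥ* hcat A B) (Fin.natAdd a j) = (x ᵥ* B) j := by
  simp [vecMul, dotProduct, -Fin.natAdd_eq_addNat]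

lemma vecMul_vcat (y : Fin (a + b) → ZMod s)
    (A : Matrix (Fin a) r (ZMod s)) (B : Matrix (Fin b) r (ZMod s)) :
    y ᵥ* vcat A B = (fun i => y (Fin.castAdd b i)) ᵥ* A + (fun i => y (Fin.natAdd a i)) ᵥ* B := by
  ext j
  simp [vecMul, dotProduct, Fin.sum_univ_add, -Fin.natAdd_eq_addNat]

end Blocks

lemma linearIndependent_of_vecMul {G : Matrix (Fin p ⊕ Fin q) (Fin n) (ZMod s)}
    (h : ∀ x y, x ᵥ* G.toRows₁ + y ᵥ* G.toRows₂ = 0 → x = 0 ∧ y = 0) :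
    LinearIndependent (ZMod s) G.row := by
  rw [← vecMul_injective_iff]
  change Function.Injective G.vecMulLinear
  rw [injective_iff_map_eq_zero]
  intro z hz
  have hz' : z ᵥ* G = 0 := hz
  rw [← fromRows_toRows G, vecMul_fromRows] at hz'
  obtain ⟨hx, hy⟩ := h _ _ hz'
  ext i
  obtain i | i := i
  · exact congrFun hx i
  · exact congrFun hy i

/-- Subtracting `C` times the top block from (C | D) leaves (0 | 1) in the first two blocks, so
elimination makes the matrix unitriangular. -/
lemma linearIndependent_blockGen {k : ℕ} {B C D : Matrix (Fin p) (Fin p) (ZMod s)}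
    (hD : D = C * B + 1) (Y : Matrix (Fin p) (Fin k) (ZMod s)) :
    LinearIndependent (ZMod s) (blockGen B C D Y).row := by
  refine linearIndependent_of_vecMul fun x y h => ?_
  simp only [blockGen, toRows₁_fromRows, toRows₂_fromRows, vecMul_vcat] at h
  have h1 : x + (fun i => y (Fin.castAdd k i)) ᵥ* C = 0 := by
    ext i
    simpa only [Pi.add_apply, vecMul_hcat_castAdd, vecMul_hcat_natAdd, vecMul_one, vecMul_zero,
      add_zero, zero_add, Pi.zero_apply] using congrFun h (Fin.castAdd k (Fin.castAdd p i))
  have h2 : x ᵥ* B + (fun i => y (Fin.castAdd k i)) ᵥ* D = 0 := by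
    ext i
    simpa only [Pi.add_apply, vecMul_hcat_castAdd, vecMul_hcat_natAdd, vecMul_one, vecMul_zero,
      add_zero, zero_add, Pi.zero_apply] using congrFun h (Fin.castAdd k (Fin.natAdd p i))
  have h3 : x ᵥ* Y + (fun i => y (Fin.natAdd p i)) = 0 := by
    ext i
    simpa only [Pi.add_apply, vecMul_hcat_castAdd, vecMul_hcat_natAdd, vecMul_one, vecMul_zero,
      add_zero, zero_add, Pi.zero_apply] using congrFun h (Fin.natAdd (p + p) i)
  rw [hD, vecMul_add, ← vecMul_vecMul, ← add_assoc, ← add_vecMul, h1, zero_vecMul, zero_add,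
    vecMul_one] at h2
  rw [h2, zero_vecMul, add_zero] at h1
  rw [h1, zero_vecMul, zero_add] at h3
  refine ⟨h1, ?_⟩
  ext i
  induction i using Fin.addCases with
  | left i => exact congrFun h2 i
  | right i => exact congrFun h3 i

/-- Adjoining an identity block preserves pairwise independence of the columns. -/
lemma PairwiseIndepCols.vcat_hcat {m k : ℕ} {E : Matrix (Fin p) (Fin m) (ZMod s)}
    (hE : PairwiseIndepCols E) {Z : Matrix (Fin k) (Fin m) (ZMod s)} (hZ : Z = 0) :
    PairwiseIndepCols (vcat (hcat E 0) (hcat Z (1 : Matrix (Fin k) (Fin k) (ZMod s)))) := by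
  subst hZ
  constructor
  · intro l
    induction l using Fin.addCases with
    | left j =>
      obtain ⟨i, hi⟩ := hE.ne_zero j
      exact ⟨Fin.castAdd k i, by simpa using hi⟩
    | right j => exact ⟨Fin.natAdd p j, by simp [-Fin.natAdd_eq_addNat]⟩
  · intro l m' hlm v hv
    induction l using Fin.addCases with
    | left j =>
      induction m' using Fin.addCases with
      | left j' =>
        obtain ⟨i, hi⟩ := hE.add_ne_zero j j' (fun h => hlm (by rw [h])) v hv
        exact ⟨Fin.castAdd k i, by simpa using hi⟩
      | right j' => exact ⟨Fin.natAdd p j', by simp [-Fin.natAdd_eq_addNat, hv]⟩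
    | right j =>
      induction m' using Fin.addCases with
      | left j' => exact ⟨Fin.natAdd p j, by simp [-Fin.natAdd_eq_addNat]⟩
      | right j' =>
        have : j ≠ j' := fun h => hlm (by rw [h])
        exact ⟨Fin.natAdd p j, by simp [-Fin.natAdd_eq_addNat, one_apply, this]⟩

/-! ### Points of the projective geometry -/

/-- The point spanned by a column. -/
noncomputable def colPoint (A : Matrix (Fin p) (Fin n) (ZMod s)) (hA : NoZeroCol A) (j : Fin n) :
    Projectivization (ZMod s) (Fin p → ZMod s) := Projectivization.mk _ (A.col j) (hA j)

lemma mem_submodule_iff_mk_eq {v : Fin p → ZMod s} (hv : v ≠ 0)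
    (x : Projectivization (ZMod s) (Fin p → ZMod s)) :
    v ∈ x.submodule ↔ Projectivization.mk _ v hv = x := by
  induction x using Projectivization.ind with | _ w hw
  rw [Projectivization.submodule_mk, Submodule.mem_span_singleton,
    Projectivization.mk_eq_mk_iff']

open Classical in
lemma pointCount_eq {A : Matrix (Fin p) (Fin n) (ZMod s)} (hA : NoZeroCol A)
    (x : Projectivization (ZMod s) (Fin p → ZMod s)) :
    pointCount A x = (Finset.univ.filter fun j => colPoint A hA j = x).card := by
  rw [pointCount, Set.ncard_eq_toFinset_card']
  congr 1
  ext j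
  rw [Set.mem_toFinset, Finset.mem_filter_univ, Set.mem_ofPred_eq, mem_submodule_iff_mk_eq (hA j)]
  exact and_iff_right (hA j)

omit [Fact s.Prime] in
lemma noZeroCol_hcat {a b : ℕ} {A : Matrix (Fin p) (Fin a) (ZMod s)}
    {B : Matrix (Fin p) (Fin b) (ZMod s)} (hA : NoZeroCol A) (hB : NoZeroCol B) :
    NoZeroCol (hcat A B) := by
  intro j h
  induction j using Fin.addCases with
  | left j => exact hA j (funext fun i => by simpa [-Fin.natAdd_eq_addNat] using congrFun h i)
  | right j => exact hB j (funext fun i => by simpa [-Fin.natAdd_eq_addNat] using congrFun h i)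

lemma PairwiseIndepCols.noZeroCol {A : Matrix (Fin p) (Fin n) (ZMod s)}
    (hA : PairwiseIndepCols A) : NoZeroCol A := by
  intro j h
  obtain ⟨i, hi⟩ := hA.ne_zero j
  exact hi (congrFun h i)

/-- The prescribed columns thus use each point at most once, the starting condition of
`exists_balanced`. -/
lemma PairwiseIndepCols.injective_colPoint {A : Matrix (Fin p) (Fin n) (ZMod s)}
    (hA : PairwiseIndepCols A) : Function.Injective (colPoint A hA.noZeroCol) := by
  intro l m h
  by_contra hlm
  obtain ⟨a, ha⟩ := (Projectivization.mk_eq_mk_iff' _ _ _ _ _).1 h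
  have ha0 : a ≠ 0 := by
    rintro rfl
    exact hA.noZeroCol l (by rw [← ha, zero_smul])
  obtain ⟨i, hi⟩ := hA.add_ne_zero l m hlm (-a) (neg_ne_zero.2 ha0)
  apply hi
  have := congrFun ha i
  simp only [Pi.smul_apply, smul_eq_mul, col_apply] at this
  rw [← this]; ring

/-- An undetected component means that column `l` is `-v` times column `m`, which puts both at one
point. -/
lemma detects_of_colPoint_ne {A : Matrix (Fin p) (Fin n) (ZMod s)} (hA : NoZeroCol A)
    {l m : Fin n} {v : ZMod s} (h : l < m ∧ v ≠ 0) (hlm : colPoint A hA l ≠ colPoint A hA m) :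
    Detects A (Sum.inr ⟨(l, m, v), h⟩) := by
  by_contra h0
  simp only [Detects, not_exists, not_not, effectLevel] at h0
  refine hlm ((Projectivization.mk_eq_mk_iff' _ _ _ _ _).2 ⟨-v, ?_⟩)
  ext i
  simp only [Pi.smul_apply, smul_eq_mul, col_apply]
  linear_combination -(h0 i)

lemma card_projectivization (p s : ℕ) [Fact s.Prime] :
    s ^ p = Nat.card (Projectivization (ZMod s) (Fin p → ZMod s)) * (s - 1) + 1 := by
  have := Projectivization.card' (ZMod s) (Fin p → ZMod s)
  simpa [Nat.card_eq_fintype_card, ZMod.card] using this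

/-- Points can be appended to a sequence of distinct points such that all points are used almost
equally often. -/
lemma exists_balanced {T : Type*} [Fintype T] [DecidableEq T] [Nonempty T] (f : T → ℕ)
    (hf : ∀ x, f x ≤ 1) (k : ℕ) : ∃ g : Fin k → T, ∀ x y,
      f x + (Finset.univ.filter fun j => g j = x).card ≤
        f y + (Finset.univ.filter fun j => g j = y).card + 1 := by
  induction k with
  | zero =>
    refine ⟨Fin.elim0, fun x y => ?_⟩
    have := hf x
    simp; omega
  | succ k ih =>
    obtain ⟨g, hg⟩ := ih
    -- Greedy choice: the next point is one used least so far.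
    obtain ⟨z, hz⟩ := Finite.exists_min fun x =>
      f x + (Finset.univ.filter fun j => g j = x).card
    have key (x) : (Finset.univ.filter fun j => (Fin.cons z g : Fin (k + 1) → T) j = x).card =
        (if z = x then 1 else 0) + (Finset.univ.filter fun j => g j = x).card := by
      simp only [Finset.card_filter, Fin.sum_univ_succ, Fin.cons_zero, Fin.cons_succ]
    refine ⟨Fin.cons z g, fun x y => ?_⟩
    rw [key, key]
    have h1 := hg x y
    have h2 := hz y
    split_ifs with hx hy hy
    · omega
    · subst hx; omega
    · omega
    · omega

lemma eq_div_card_or_of_balanced {T : Type*} [Fintype T] [Nonempty T] {N : T → ℕ} {n : ℕ}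
    (hn : ∑ x, N x = n) (hN : ∀ x y, N x ≤ N y + 1) (x : T) :
    N x = n / Fintype.card T ∨ N x = n / Fintype.card T + 1 := by
  obtain ⟨z, hz⟩ := Finite.exists_min N
  have : n / Fintype.card T = N z := by
    rw [Nat.div_eq_iff Fintype.card_pos]
    have h1 : Fintype.card T * N z ≤ n := by
      rw [← hn, ← smul_eq_mul, ← Finset.card_univ]
      exact Finset.card_nsmul_le_sum _ _ _ fun x _ => hz x
    have h2 : n < Fintype.card T * (N z + 1) := by
      rw [← hn, ← smul_eq_mul, ← Finset.card_univ, ← Finset.sum_const]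
      exact Finset.sum_lt_sum (fun x _ => hN x z) ⟨z, Finset.mem_univ z, Nat.lt_succ_self _⟩
    constructor
    · nlinarith
    · have := Fintype.card_pos (α := T)
      have h3 : Fintype.card T * (N z + 1) = N z * Fintype.card T + Fintype.card T := by ring
      omega
  rw [this]
  have := hz x
  have := hN x z
  omega

instance : Nonempty (Projectivization (ZMod s) (Fin (p + 1) → ZMod s)) :=
  ⟨Projectivization.mk _ (Pi.single 0 1) (by simp)⟩

lemma exists_isBalanced_hcat {m k : ℕ} [Nonempty (Projectivization (ZMod s) (Fin p → ZMod s))]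
    {W : Matrix (Fin p) (Fin m) (ZMod s)} (hW : PairwiseIndepCols W) :
    ∃ Y : Matrix (Fin p) (Fin k) (ZMod s), NoZeroCol Y ∧ IsBalanced (hcat W Y)
      ((m + k) / Nat.card (Projectivization (ZMod s) (Fin p → ZMod s))) := by
  classical
  have := Fintype.ofFinite (Projectivization (ZMod s) (Fin p → ZMod s))
  obtain ⟨g, hg⟩ := exists_balanced
    (fun x => (Finset.univ.filter fun j => colPoint W hW.noZeroCol j = x).card)
    (fun x => Finset.card_le_one.2 fun i hi j hj => hW.injective_colPoint
      ((Finset.mem_filter.1 hi).2.trans (Finset.mem_filter.1 hj).2.symm)) k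
  let Y : Matrix (Fin p) (Fin k) (ZMod s) := Matrix.of fun i j => (g j).rep i
  have hY : NoZeroCol Y := fun j => (g j).rep_nonzero
  have hYp (j) : colPoint Y hY j = g j := (g j).mk_rep
  have hWY := noZeroCol_hcat hW.noZeroCol hY
  have hl (j) : colPoint (hcat W Y) hWY (Fin.castAdd k j) = colPoint W hW.noZeroCol j := by
    unfold colPoint
    congr 1
    ext i; simp [-Fin.natAdd_eq_addNat]
  have hr (j) : colPoint (hcat W Y) hWY (Fin.natAdd m j) = g j := by
    rw [← hYp]
    unfold colPoint
    congr 1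
    ext i; simp [-Fin.natAdd_eq_addNat]
  have hcount (x) : pointCount (hcat W Y) x =
      (Finset.univ.filter fun j => colPoint W hW.noZeroCol j = x).card +
        (Finset.univ.filter fun j => g j = x).card := by
    rw [pointCount_eq hWY]
    simp only [Finset.card_filter, Fin.sum_univ_add, hl, hr]
  refine ⟨Y, hY, ?_⟩
  rw [Nat.card_eq_fintype_card]
  refine eq_div_card_or_of_balanced ?_ fun x y => by rw [hcount, hcount]; exact hg x y
  simp only [pointCount_eq hWY]
  simp only [Finset.card_filter]
  rw [Finset.sum_comm]
  simp

/-- The bottom block detects every effect, so confounding is decided by the top block, and the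
points serve as the classes of the Turán partition. -/
lemma yieldsTwoFiOptimal_blockGen {k : ℕ} [Nonempty (Projectivization (ZMod s) (Fin p → ZMod s))]
    {B C D : Matrix (Fin p) (Fin p) (ZMod s)}
    (hD : D = C * B + 1) (hB : PairwiseIndepCols (hcat (1 : Matrix (Fin p) (Fin p) (ZMod s)) B)) (hCD : PairwiseIndepCols (hcat C D))
    {Y : Matrix (Fin p) (Fin k) (ZMod s)} (hY : NoZeroCol Y)
    (hbal : IsBalanced (hcat (hcat (1 : Matrix (Fin p) (Fin p) (ZMod s)) B) Y)
      ((p + p + k) / Nat.card (Projectivization (ZMod s) (Fin p → ZMod s)))) :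
    YieldsTwoFiOptimal.{u} (blockGen B C D Y) := by
  classical
  have := Fintype.ofFinite (Projectivization (ZMod s) (Fin p → ZMod s))
  have hA := noZeroCol_hcat hB.noZeroCol hY
  have hcard := card_projectivization p s
  rw [Nat.card_eq_fintype_card] at hcard hbal
  have hE : PairwiseIndepCols (blockGen B C D Y).toRows₂ := by
    rw [blockGen, toRows₂_fromRows]
    refine hCD.vcat_hcat ?_
    ext i j
    induction j using Fin.addCases <;> simp [-Fin.natAdd_eq_addNat]
  have htop : (blockGen B C D Y).toRows₁ = hcat (hcat (1 : Matrix (Fin p) (Fin p) (ZMod s)) B) Y := toRows₁_fromRows _ _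
  refine yieldsTwoFiOptimal_of_balanced (by ring) (linearIndependent_blockGen hD Y) hcard
    (colPoint _ hA) (fun l => ⟨?_, hE.detects _⟩) (fun l m v h hlm => ⟨?_, hE.detects _⟩)
    fun x => by simpa only [pointCount_eq hA] using hbal x
  · rw [htop]
    exact Function.ne_iff.1 (hA l)
  · rw [htop]
    exact detects_of_colPoint_ne hA h hlm

/-! ### The three cases -/

omit [Fact s.Prime] in
lemma exchange_apply (v s : ℕ) (i j : Fin v) : exchange v s i j = if i = j.rev then 1 else 0 := by
  simp only [exchange, of_apply, Fin.ext_iff, Fin.val_rev]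
  congr 1
  simp only [eq_iff_iff]
  omega

lemma exchange_mul (v s a : ℕ) (A : Matrix (Fin v) (Fin a) (ZMod s)) (i : Fin v) (j : Fin a) :
    (exchange v s * A) i j = A i.rev j := by
  rw [mul_apply, Finset.sum_eq_single i.rev]
  · simp [exchange_apply]
  · intro b _ hb
    have : i ≠ b.rev := fun h => hb (by rw [h, Fin.rev_rev])
    simp [exchange_apply, this]
  · simp

lemma two_ne_zero_of_odd (hs : Odd s) : (2 : ZMod s) ≠ 0 := by
  intro h
  have : s ∣ 2 := (ZMod.natCast_eq_zero_iff 2 s).1 (by exact_mod_cast h)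
  have h2 := (Nat.prime_dvd_prime_iff_eq (Fact.out : s.Prime) Nat.prime_two).1 this
  rw [h2] at hs
  exact absurd hs (by decide)

/-- PG(0, s) is a single point, so there is one class and no interaction to check; only full rank
and the main effects remain. -/
lemma yieldsTwoFiOptimal_genA (hs : Odd s) (q : ℕ) (hq : 1 ≤ q) : YieldsTwoFiOptimal.{u} (genA q s) := by
  have hs1 : 1 ≤ s := (Fact.out : s.Prime).one_le
  refine yieldsTwoFiOptimal_of_balanced (T := Unit) rfl ?_ (by simp; omega) (fun _ => ())
    (fun l => ?_) (fun l m v h hlm => absurd rfl hlm) fun _ => by simp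
  · refine linearIndependent_of_vecMul fun x y h => ?_
    simp only [genA, toRows₁_fromRows, toRows₂_fromRows] at h
    have h0 : x 0 + ∑ i, y i = 0 := by
      simpa [vecMul_hcat_castAdd, ones, vecMul, dotProduct] using congrFun h (Fin.castAdd q 0)
    have h1 (j) : x 0 + (y j + ∑ i, y i) = 0 := by
      simpa [vecMul_hcat_natAdd, ones, vecMul_add, vecMul, dotProduct, one_apply, mul_add,
        Finset.sum_add_distrib] using congrFun h (Fin.natAdd 1 j)
    have hy : y = 0 := by
      ext j
      change y j = 0
      linear_combination h1 j - h0
    refine ⟨?_, hy⟩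
    ext i
    rw [Subsingleton.elim i 0]
    simpa [hy] using h0
  · induction l using Fin.addCases with
    | left i =>
      exact ⟨⟨0, by simp [genA, effectLevel, ones]⟩, ⟨⟨0, hq⟩, by simp [genA, effectLevel, ones]⟩⟩
    | right j =>
      refine ⟨⟨0, by simp [genA, effectLevel, ones]⟩, ⟨j, ?_⟩⟩
      simpa [genA, effectLevel, ones, one_add_one_eq_two] using two_ne_zero_of_odd hs

/-- The maximal minors are ±1 and 2, nonzero because `s` is odd. -/
lemma pairwiseIndepCols_topB (hs : Odd s) : PairwiseIndepCols (hcat (1 : Matrix (Fin 2) (Fin 2) (ZMod s)) (matM s)) := by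
  have h2 := two_ne_zero_of_odd hs
  have h : hcat (1 : Matrix (Fin 2) (Fin 2) (ZMod s)) (matM s) =
      (!![1, 0, 1, 1; 0, 1, 2, 1] : Matrix (Fin 2) (Fin 4) (ZMod s)) := by
    ext i j
    fin_cases i <;> fin_cases j <;> rfl
  rw [h]
  refine pairwiseIndepCols_of_minors (n := 4) (by norm_num) fun l m hlm => ?_
  fin_cases l <;> fin_cases m <;> first | exact absurd hlm (by decide) | skip
  all_goals simp
  · exact h2
  · exact fun h0 => one_ne_zero (α := ZMod s) (by linear_combination -h0)

/-- The maximal minors are ±1 and ±2. -/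
lemma pairwiseIndepCols_bottomB (hs : Odd s) : PairwiseIndepCols (hcat (1 : Matrix (Fin 2) (Fin 2) (ZMod s)) (matM s + 1)) := by
  have h2 := two_ne_zero_of_odd hs
  have h : hcat (1 : Matrix (Fin 2) (Fin 2) (ZMod s)) (matM s + 1) =
      (!![1, 0, 1 + 1, 1 + 0; 0, 1, 2 + 0, 1 + 1] : Matrix (Fin 2) (Fin 4) (ZMod s)) := by
    ext i j
    fin_cases i <;> fin_cases j <;> rfl
  rw [h]
  refine pairwiseIndepCols_of_minors (n := 4) (by norm_num) fun l m hlm => ?_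
  fin_cases l <;> fin_cases m <;> first | exact absurd hlm (by decide) | skip
  all_goals simp
  all_goals exact fun h0 => h2 (by first | linear_combination h0 | linear_combination -h0)

lemma pairwiseIndepCols_topC (hp : 3 ≤ p) :
    PairwiseIndepCols (hcat (1 : Matrix (Fin p) (Fin p) (ZMod s)) (ones p p s + exchange p s)) :=
  pairwiseIndepCols_unit_ones hp one_ne_zero (π := id) (ρ := Fin.rev) Function.injective_id
    Fin.rev_injective (fun a i => by simp [one_apply])
    fun a j => by simp [-Fin.natAdd_eq_addNat, ones, exchange_apply]

lemma pairwiseIndepCols_bottomC (hs : Odd s) (hp : 3 ≤ p) :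
    PairwiseIndepCols (hcat (exchange p s) (ones p p s + (2 : ZMod s) • 1)) :=
  pairwiseIndepCols_unit_ones hp (two_ne_zero_of_odd hs) (π := Fin.rev) (ρ := id)
    Fin.rev_injective Function.injective_id (fun a i => by simp [exchange_apply])
    fun a j => by simp [-Fin.natAdd_eq_addNat, ones, one_apply]

lemma card_points_two (s : ℕ) [Fact s.Prime] :
    Nat.card (Projectivization (ZMod s) (Fin 2 → ZMod s)) = s + 1 := by
  rw [Projectivization.card_of_finrank_two _ _ (by simp), Nat.card_zmod]

lemma mul_div_eq_div_card (p s n : ℕ) [Fact s.Prime] : n * (s - 1) / (s ^ p - 1) =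
    n / Nat.card (Projectivization (ZMod s) (Fin p → ZMod s)) := by
  rw [card_projectivization p s, Nat.add_sub_cancel,
    Nat.mul_div_mul_right _ _ (Nat.sub_pos_of_lt (Fact.out : s.Prime).one_lt)]

end Constructions
end RowColumn

theorem theorem4 (s : ℕ) [Fact s.Prime] (hs : Odd s) :
    -- case (a): `1 = p ≤ q`
    (∀ q : ℕ, 1 ≤ q → RowColumn.YieldsTwoFiOptimal.{u} (RowColumn.genA q s)) ∧
    -- case (b): `2 = p ≤ q`, where `q = 2 + k` and `n = p + q = 2 + 2 + k`
    (∀ k : ℕ,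
      (∃ X : Matrix (Fin 2) (Fin k) (ZMod s), RowColumn.NoZeroCol X ∧
        RowColumn.IsBalanced (RowColumn.topB X) ((2 + 2 + k) / (s + 1))) ∧
      ∀ X : Matrix (Fin 2) (Fin k) (ZMod s), RowColumn.NoZeroCol X →
        RowColumn.IsBalanced (RowColumn.topB X) ((2 + 2 + k) / (s + 1)) →
        RowColumn.YieldsTwoFiOptimal.{u} (RowColumn.genB X)) ∧
    -- case (c): `3 ≤ p ≤ q`, where `q = p + k` and `n = p + q = p + p + k`
    (∀ p k : ℕ, 3 ≤ p →
      (∃ Y : Matrix (Fin p) (Fin k) (ZMod s), RowColumn.NoZeroCol Y ∧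
        RowColumn.IsBalanced (RowColumn.topC Y) ((p + p + k) * (s - 1) / (s ^ p - 1))) ∧
      ∀ Y : Matrix (Fin p) (Fin k) (ZMod s), RowColumn.NoZeroCol Y →
        RowColumn.IsBalanced (RowColumn.topC Y) ((p + p + k) * (s - 1) / (s ^ p - 1)) →
        RowColumn.YieldsTwoFiOptimal.{u} (RowColumn.genC Y)) := by
  refine ⟨RowColumn.yieldsTwoFiOptimal_genA hs, fun k => ?_, fun p k hp => ?_⟩
  · rw [← RowColumn.card_points_two s]
    refine ⟨RowColumn.exists_isBalanced_hcat (RowColumn.pairwiseIndepCols_topB hs),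
      fun X hX hbal => RowColumn.yieldsTwoFiOptimal_blockGen (by rw [one_mul])
        (RowColumn.pairwiseIndepCols_topB hs) (RowColumn.pairwiseIndepCols_bottomB hs) hX hbal⟩
  · rw [RowColumn.mul_div_eq_div_card p s]
    -- The instance that provides a point of the projective space is stated for dimension `p' + 1`.
    obtain ⟨p, rfl⟩ : ∃ p', p = p' + 1 := ⟨p - 1, by omega⟩
    refine ⟨RowColumn.exists_isBalanced_hcat (RowColumn.pairwiseIndepCols_topC hp),
      fun Y hY hbal => RowColumn.yieldsTwoFiOptimal_blockGen ?_
        (RowColumn.pairwiseIndepCols_topC hp) (RowColumn.pairwiseIndepCols_bottomC hs hp)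
        hY hbal⟩
    -- Since H J = J and H² = I, the required identity is H(J + H) + I = J + 2I.
    ext i j
    rw [Matrix.add_apply, Matrix.add_apply, RowColumn.exchange_mul]
    have : (i.rev = j.rev) = (i = j) := by simp
    simp only [RowColumn.ones, Matrix.add_apply, RowColumn.exchange_apply, Matrix.of_apply,
      Matrix.smul_apply, Matrix.one_apply, smul_eq_mul, this]
    split_ifs <;> ring
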